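/- **Setting.** Let $\mathbb F$ be a field of characteristic $0$ and $\mathcal V$ a differential algebra over $\mathbb F$: a unital commutative associative $\mathbb F$-algebra with an $\mathbb F$-linear derivation $\partial$. Let $\int:\mathcal V\to\mathcal V/\partial\mathcal V$ be the quotient map, and $\mathcal V((\partial^{-1}))$ the algebra of pseudodifferential operators $A(\partial)=\sum_{n\le M}a_n\partial^n$, with symbol $A(z)=\sum_n a_nz^n$ and product $(A\circ B)(z)=A(z+\partial)B(z)$; put $A_+=\sum_{n\ge 0}a_n\partial^n$, $\operatorname{Res}_zA(z)=a_{-1}$ and $A^*(\partial)=\sum_n(-\partial)^n\circ a_n$. A $\lambda$-bracket on $\mathcal V$ is an $\mathbb F$-bilinear map $\{\cdot\,_\lambda\,\cdot\}:\mathcal V\times\mathcal V\to\mathcal V[\lambda]$ with $\{\partial a_\lambda b\}=-\lambda\{a_\lambda b\}$, $\{a_\lambda\partial b\}=(\lambda+\partial)\{a_\lambda b\}$, $\{a_\lambda bc\}=\{a_\lambda b\}c+\{a_\lambda c\}b$ and $\{ab_\lambda c\}=\{a_{\lambda+x}c\}(|_{x=\partial}b)+\{b_{\lambda+x}c\}(|_{x=\partial}a)$,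 where $p(\lambda+x)(|_{x=\partial}b)=\sum_np_n(\lambda+\partial)^nb$ for $p(\lambda)=\sum_n p_n\lambda^n$. It induces $\{\int f,g\}=\{f_\lambda g\}|_{\lambda=0}$ and $\{\int f,\int g\}=\int\{f_\lambda g\}|_{\lambda=0}$. It is a Poisson vertex algebra (PVA) $\lambda$-bracket on a differential subalgebra $\mathcal U$ if it maps $\mathcal U\times\mathcal U$ to $\mathcal U[\lambda]$ and satisfies on $\mathcal U$ skewsymmetry, $\{b_\lambda a\}=-\sum_n(-\lambda-\partial)^nc_n$ where $\{a_\lambda b\}=\sum_n c_n\lambda^n$, and the Jacobi identity $\{a_\lambda\{b_\mu c\}\}-\{b_\mu\{a_\lambda c\}\}=\{\{a_\lambda b\}_{\lambda+\mu}c\}$. A matrix $A\in\operatorname{Mat}_{N\times N}\mathcal V((\partial^{-1}))$ is of Adler type for a $\lambda$-bracket if for all $i,j,h,k$ $$\{A_{ij}(z)_\lambda A_{hk}(w)\}=A_{hj}(w+\lambda+\partial)\,\iota_z(z-w-\lambda-\partial)^{-1}(A_{ik})^*(\lambda-z)-A_{hj}(z)\,\iota_z(z-w-\lambda-\partial)^{-1}A_{ik}(w),$$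 where $\iota_z$ is the geometric expansion for large $z$. Given two $\lambda$-brackets $\{\cdot\,_\lambda\,\cdot\}_0$, $\{\cdot\,_\lambda\,\cdot\}_1$ on $\mathcal V$, $A$ is of bi-Adler type if for every $\epsilon\in\mathbb F$ the matrix $A+\epsilon\mathbb 1_N$ is of Adler type for $\{\cdot\,_\lambda\,\cdot\}_0+\epsilon\{\cdot\,_\lambda\,\cdot\}_1$. **Theorem.** Let $A\in\operatorname{Mat}_{N\times N}\mathcal V((\partial^{-1}))$ be invertible and of bi-Adler type with respect to $\{\cdot\,_\lambda\,\cdot\}_0$ and $\{\cdot\,_\lambda\,\cdot\}_1$. For a $K$-th root $B$ of $A$ ($B^K=A$, $K\in\mathbb Z\setminus\{0\}$) put $$h_{n,B}=-\frac Kn\operatorname{Res}_z\operatorname{tr}(B^n(z))\quad(n\in\mathbb Z\setminus\{0\}),\qquad h_{0,B}=0.$$ Let $\mathcal V_1\subset\mathcal V$ be the differential subalgebra generated by the coefficients of the entries of $A$. 1. For every $K$-th root $B$ of $A$ and every $n\in\mathbb Z$, $\{\int h_{n,B},A(z)\}_0=[(B^n)_+,A](z)$, and for $n\ne-K$ the generalized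 Lenard–Magri recurrence holds: $$\{\textstyle\int h_{n,B},A(z)\}_0=\{\textstyle\int h_{n+K,B},A(z)\}_1=[(B^n)_+,A](z).$$ 2. $\mathcal V_1$ is a bi-PVA: for every $\epsilon\in\mathbb F$, $\{\cdot\,_\lambda\,\cdot\}_0+\epsilon\{\cdot\,_\lambda\,\cdot\}_1$ is a PVA $\lambda$-bracket on $\mathcal V_1$. 3. The equations $\frac{du}{dt_{n,B}}=\{\int h_{n,B},u\}_0=\{\int h_{n+K,B},u\}_1$ are bi-Hamiltonian on $\mathcal V_1$: the second equality holds for every $K$-th root $B$, every $n\ne-K$ and every $u\in\mathcal V_1$. 4. For all roots $B,C$ of $A$ and all $m,n\in\mathbb Z$, $\{\int h_{m,B},\int h_{n,C}\}_0=\{\int h_{m,B},\int h_{n,C}\}_1=0$. Thus the Hamiltonian functionals are in involution for both brackets, and all of them are integrals of motion of all the equations. 5. The equations are compatible on $\mathcal V_1$: whenever $\int h_{m,B}$ and $\int h_{n,C}$ are local functionals of $\mathcal V_1$ (lie in the image $\int\mathcal V_1$), the maps $u\mapsto\{\int h_{m,B},u\}_i$ and $u\mapsto\{\int h_{n,C},u\}_i$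 ($i=0,1$) send $\mathcal V_1$ to itself and commute on $\mathcal V_1$. -/

import Mathlib

open Polynomial

section Calculus

open Finset.HasAntidiagonal (antidiagonal mem_antidiagonal)

variable {F : Type*} [Field F] {V : Type*} [CommRing V] [Algebra F V]

/-- The coefficient of `w ^ s` in the expansion
`(w + T) ^ q = ∑ r ≥ 0, binom(q, r) w ^ (q - r) T ^ r` in non-negative powers of `T`. -/
noncomputable def powCoeff {M : Type*} [AddCommGroup M] [Module F M] (T : Module.End F M)
    (q s : ℤ) : Module.End F M :=
  if s ≤ q then Ring.choose q (q - s).toNat • T ^ (q - s).toNat else 0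

theorem powCoeff_sub {M : Type*} [AddCommGroup M] [Module F M] (T : Module.End F M)
    (q s : ℤ) (j : ℕ) (h : s = q - j) :
    powCoeff T q s = Ring.choose q j • T ^ j := by
  subst h; simp [powCoeff]

theorem powCoeff_of_lt {M : Type*} [AddCommGroup M] [Module F M] (T : Module.End F M)
    (q s : ℤ) (h : q < s) : powCoeff T q s = 0 := by
  simp [powCoeff, not_le.2 h]

theorem derivation_pow_mul (D : Derivation F V V) (k : ℕ) (b c : V) :
    ((D : Module.End F V) ^ k) (b * c) =
      ∑ ij ∈ antidiagonal k,
        k.choose ij.1 • (((D : Module.End F V) ^ ij.1) b * ((D : Module.End F V) ^ ij.2) c) := by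
  induction k with
  | zero => simp
  | succ k ih =>
    rw [Finset.sum_antidiagonal_choose_succ_nsmul
      (fun i j => ((D : Module.End F V) ^ i) b * ((D : Module.End F V) ^ j) c),
      pow_succ', Module.End.mul_apply, ih, map_sum, ← Finset.sum_add_distrib]
    refine Finset.sum_congr rfl fun ij hij => ?_
    rw [← Nat.choose_symm_of_eq_add (mem_antidiagonal.mp hij).symm, ← smul_add,
      map_nsmul, pow_succ', pow_succ', Module.End.mul_apply, Module.End.mul_apply]
    congr 1
    simp only [Derivation.coeFn_coe, Derivation.leibniz, smul_eq_mul]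
    ring

theorem choose_assoc (m q : ℤ) (i l : ℕ) :
    ∑ jr ∈ antidiagonal l,
      (i + jr.1).choose i • (Ring.choose m (i + jr.1) * Ring.choose q jr.2) =
      Ring.choose m i * Ring.choose (m + q - i) l := by
  rw [show m + q - i = (m - i) + q by ring, Ring.add_choose_eq l (Commute.all _ _), Finset.mul_sum]
  refine Finset.sum_congr rfl fun jr _ => ?_
  rw [← smul_mul_assoc, Ring.choose_smul_choose m (Nat.le_add_right i jr.1)]
  simp [mul_assoc]

theorem powCoeff_assoc (D : Derivation F V V) (m q p n : ℤ) (b c : V) (J J' : Finset ℤ)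
    (h1 : ∀ s, n - p ≤ s → s ≤ m + q → s ∈ J) (h2 : ∀ r, n - m ≤ r → r ≤ p + q → r ∈ J') :
    ∑ s ∈ J, powCoeff (D : Module.End F V) m (s - q) b *
        powCoeff (D : Module.End F V) s (n - p) c =
      ∑ r ∈ J', powCoeff (D : Module.End F V) m (n - r)
        (b * powCoeff (D : Module.End F V) q (r - p) c) := by
  by_cases hk : m + q + p < n
  · rw [Finset.sum_eq_zero, Finset.sum_eq_zero]
    · intro r _
      by_cases h : m < n - r
      · simp [powCoeff_of_lt _ _ _ h]
      · rw [powCoeff_of_lt _ q (r - p) (by omega)]; simp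
    · intro s _
      by_cases h : m < s - q
      · simp [powCoeff_of_lt _ _ _ h]
      · rw [powCoeff_of_lt _ s (n - p) (by omega)]; simp
  obtain ⟨k, hk⟩ := Int.le.dest (not_lt.1 hk)
  have e1 : ∑ s ∈ J, powCoeff (D : Module.End F V) m (s - q) b *
        powCoeff (D : Module.End F V) s (n - p) c =
      ∑ ij ∈ antidiagonal k, (Ring.choose m ij.1 * Ring.choose (m + q - ij.1) ij.2) •
        (((D : Module.End F V) ^ ij.1) b * ((D : Module.End F V) ^ ij.2) c) := by
    symm
    refine Finset.sum_of_injOn (fun ij => m + q - (ij.1 : ℤ)) ?_ ?_ ?_ ?_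
    · rintro ⟨i, j⟩ hij ⟨i', j'⟩ hij' h
      simp only [Finset.mem_coe, mem_antidiagonal] at hij hij' h
      ext <;> simp only <;> omega
    · rintro ⟨i, j⟩ hij
      simp only [Finset.mem_coe, mem_antidiagonal] at hij
      exact h1 (m + q - (i : ℤ)) (by omega) (by omega)
    · intro s _ hs
      by_cases h : m < s - q
      · simp [powCoeff_of_lt _ _ _ h]
      · rw [powCoeff_of_lt _ s (n - p), LinearMap.zero_apply, mul_zero]
        by_contra h'
        apply hs
        refine ⟨((m + q - s).toNat, (s - (n - p)).toNat), ?_, ?_⟩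
        · simp only [Finset.mem_coe, mem_antidiagonal]; omega
        · simp only; omega
    · rintro ⟨i, j⟩ hij
      simp only [mem_antidiagonal] at hij
      rw [powCoeff_sub _ m _ i (by ring), powCoeff_sub _ (m + q - i) (n - p) j (by omega)]
      simp only [LinearMap.smul_apply, smul_mul_assoc, mul_smul_comm, mul_smul]
      rw [smul_comm]
  have e2 : ∑ r ∈ J', powCoeff (D : Module.End F V) m (n - r)
        (b * powCoeff (D : Module.End F V) q (r - p) c) =
      ∑ ij ∈ antidiagonal k, (Ring.choose m ij.1 * Ring.choose q ij.2) •
        (((D : Module.End F V) ^ ij.1) (b * ((D : Module.End F V) ^ ij.2) c)) := by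
    symm
    refine Finset.sum_of_injOn (fun ij => q + p - (ij.2 : ℤ)) ?_ ?_ ?_ ?_
    · rintro ⟨i, j⟩ hij ⟨i', j'⟩ hij' h
      simp only [Finset.mem_coe, mem_antidiagonal] at hij hij' h
      ext <;> simp only <;> omega
    · rintro ⟨i, j⟩ hij
      simp only [Finset.mem_coe, mem_antidiagonal] at hij
      exact h2 (q + p - (j : ℤ)) (by omega) (by omega)
    · intro r _ hs
      by_cases h : q < r - p
      · simp [powCoeff_of_lt _ _ _ h]
      · rw [powCoeff_of_lt _ m (n - r), LinearMap.zero_apply]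
        by_contra h'
        apply hs
        refine ⟨((m - (n - r)).toNat, (q + p - r).toNat), ?_, ?_⟩
        · simp only [Finset.mem_coe, mem_antidiagonal]; omega
        · simp only; omega
    · rintro ⟨i, j⟩ hij
      simp only [mem_antidiagonal] at hij
      rw [powCoeff_sub _ q _ j (by ring), powCoeff_sub _ m (n - _) i (by omega)]
      simp only [LinearMap.smul_apply, mul_smul_comm, mul_smul, map_zsmul]
      rw [smul_comm]
  rw [e1, e2]
  simp_rw [← choose_assoc, Finset.sum_smul, derivation_pow_mul, ← Module.End.mul_apply,
    ← pow_add, Finset.smul_sum, Finset.sum_sigma']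
  refine Finset.sum_nbij' (fun x => ⟨(x.1.1 + x.2.1, x.2.2), (x.1.1, x.2.1)⟩)
    (fun y => ⟨(y.2.1, y.2.2 + y.1.2), (y.2.2, y.1.2)⟩) ?_ ?_ ?_ ?_ ?_
  · rintro ⟨⟨i, l⟩, t, r⟩ h
    simp only [Finset.mem_sigma, mem_antidiagonal] at h ⊢
    exact ⟨by omega, trivial⟩
  · rintro ⟨⟨e, r⟩, i, t⟩ h
    simp only [Finset.mem_sigma, mem_antidiagonal] at h ⊢
    exact ⟨by omega, trivial⟩
  · rintro ⟨⟨i, l⟩, t, r⟩ h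
    simp only [Finset.mem_sigma, mem_antidiagonal] at h ⊢
    simp [h.2]
  · rintro ⟨⟨e, r⟩, i, t⟩ h
    simp only [Finset.mem_sigma, mem_antidiagonal] at h ⊢
    simp [h.2]
  · rintro ⟨⟨i, l⟩, t, r⟩ h
    simp only [Finset.mem_sigma, mem_antidiagonal] at h ⊢
    rw [h.2, ← Nat.cast_smul_eq_nsmul ℤ, ← Nat.cast_smul_eq_nsmul ℤ, smul_smul, smul_eq_mul,
      mul_comm]

end Calculus

/-! ### Pseudodifferential operators -/

/-- A scalar pseudodifferential operator `∑ n, a_n ∂ ^ n` over the differential algebra `(V, D)`: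
a two-sided sequence of coefficients with `a_n = 0` for `n` large, that is, an element of
`V((∂⁻¹))`. Its symbol is `∑ n, a_n z ^ n`, with the same coefficients. -/
@[ext]
structure PseudoDiffOp {F : Type*} [Field F] {V : Type*} [CommRing V] [Algebra F V]
    (D : Derivation F V V) where
  /-- `coeff n` is the coefficient of `∂ ^ n`. -/
  coeff : ℤ → V
  exists_bound : ∃ N : ℤ, ∀ n, N < n → coeff n = 0

namespace PseudoDiffOp

variable {F : Type*} [Field F] {V : Type*} [CommRing V] [Algebra F V] {D : Derivation F V V}

instance : Zero (PseudoDiffOp D) := ⟨⟨0, 0, fun _ _ => rfl⟩⟩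

instance : Add (PseudoDiffOp D) :=
  ⟨fun A B => ⟨A.coeff + B.coeff, by
    obtain ⟨M, hM⟩ := A.exists_bound
    obtain ⟨N, hN⟩ := B.exists_bound
    exact ⟨max M N, fun n hn => by
      simp [hM n ((le_max_left _ _).trans_lt hn), hN n ((le_max_right _ _).trans_lt hn)]⟩⟩⟩

instance : Neg (PseudoDiffOp D) :=
  ⟨fun A => ⟨-A.coeff, by
    obtain ⟨M, hM⟩ := A.exists_bound
    exact ⟨M, fun n hn => by simp [hM n hn]⟩⟩⟩

instance : Sub (PseudoDiffOp D) :=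
  ⟨fun A B => ⟨A.coeff - B.coeff, by
    obtain ⟨M, hM⟩ := A.exists_bound
    obtain ⟨N, hN⟩ := B.exists_bound
    exact ⟨max M N, fun n hn => by
      simp [hM n ((le_max_left _ _).trans_lt hn), hN n ((le_max_right _ _).trans_lt hn)]⟩⟩⟩

instance : SMul ℕ (PseudoDiffOp D) :=
  ⟨fun k A => ⟨k • A.coeff, by
    obtain ⟨M, hM⟩ := A.exists_bound
    exact ⟨M, fun n hn => by simp [hM n hn]⟩⟩⟩

instance : SMul ℤ (PseudoDiffOp D) :=
  ⟨fun k A => ⟨k • A.coeff, by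
    obtain ⟨M, hM⟩ := A.exists_bound
    exact ⟨M, fun n hn => by simp [hM n hn]⟩⟩⟩

theorem coeff_injective : Function.Injective (coeff : PseudoDiffOp D → ℤ → V) :=
  fun _ _ h => PseudoDiffOp.ext h

instance : AddCommGroup (PseudoDiffOp D) :=
  coeff_injective.addCommGroup coeff rfl (fun _ _ => rfl) (fun _ => rfl) (fun _ _ => rfl)
    (fun _ _ => rfl) (fun _ _ => rfl)

@[simp] theorem coeff_zero (n : ℤ) : (0 : PseudoDiffOp D).coeff n = 0 := rfl

@[simp] theorem coeff_add (A B : PseudoDiffOp D) (n : ℤ) :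
    (A + B).coeff n = A.coeff n + B.coeff n := rfl

/-- The summand of the coefficient of `∂ ^ n` in `A ∘ B` that comes from
`a_m ∂ ^ m ∘ b_q ∂ ^ q = a_m (∂ + D) ^ m (b_q) ∂ ^ q`. -/
noncomputable def mulTerm (A B : PseudoDiffOp D) (n : ℤ) (t : ℤ × ℤ) : V :=
  A.coeff t.1 * powCoeff (D : Module.End F V) t.1 (n - t.2) (B.coeff t.2)

theorem mulTerm_eq_zero (A B : PseudoDiffOp D) {M N : ℤ} (hM : ∀ n, M < n → A.coeff n = 0)
    (hN : ∀ n, N < n → B.coeff n = 0) (n : ℤ) (t : ℤ × ℤ)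
    (h : ¬ (t.1 ≤ M ∧ t.2 ≤ N ∧ n ≤ t.1 + t.2)) : mulTerm A B n t = 0 := by
  unfold mulTerm
  by_cases h1 : M < t.1
  · simp [hM _ h1]
  by_cases h2 : N < t.2
  · simp [hN _ h2]
  rw [powCoeff_of_lt _ _ _ (by omega)]
  simp

theorem mulTerm_finite (A B : PseudoDiffOp D) (n : ℤ) :
    (Function.support (mulTerm A B n)).Finite := by
  obtain ⟨M, hM⟩ := A.exists_bound
  obtain ⟨N, hN⟩ := B.exists_bound
  refine ((Finset.Icc (n - N) M ×ˢ Finset.Icc (n - M) N).finite_toSet).subset fun t ht => ?_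
  by_contra h
  refine ht (mulTerm_eq_zero A B hM hN n t fun h' => h ?_)
  simp only [Finset.coe_product, Set.mem_prod, Finset.coe_Icc, Set.mem_Icc]
  omega

/-- The product of pseudodifferential operators: `(A ∘ B)(z) = A(z + ∂) B(z)` on symbols,
expanded in non-negative powers of `∂`. -/
noncomputable instance : Mul (PseudoDiffOp D) :=
  ⟨fun A B => ⟨fun n => ∑ᶠ t : ℤ × ℤ, mulTerm A B n t, by
    obtain ⟨M, hM⟩ := A.exists_bound
    obtain ⟨N, hN⟩ := B.exists_bound
    refine ⟨M + N, fun n hn => ?_⟩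
    rw [finsum_congr (fun t => mulTerm_eq_zero A B hM hN n t (by omega)), finsum_zero]⟩⟩

/-- Multiplication by an element of `V`, as a pseudodifferential operator of order zero. -/
def const (D : Derivation F V V) (a : V) : PseudoDiffOp D :=
  ⟨fun n => if n = 0 then a else 0, 0, fun n hn => by simp [hn.ne']⟩

instance : One (PseudoDiffOp D) := ⟨const D 1⟩

theorem coeff_mul (A B : PseudoDiffOp D) (n : ℤ) :
    (A * B).coeff n = ∑ᶠ t : ℤ × ℤ, mulTerm A B n t := rfl

theorem coeff_one (n : ℤ) : (1 : PseudoDiffOp D).coeff n = if n = 0 then 1 else 0 := rfl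

theorem coeff_mul_eq_sum (A B : PseudoDiffOp D) {M N : ℤ} (hM : ∀ n, M < n → A.coeff n = 0)
    (hN : ∀ n, N < n → B.coeff n = 0) (n : ℤ) (I J : Finset ℤ)
    (hI : ∀ m, n - N ≤ m → m ≤ M → m ∈ I) (hJ : ∀ q, n - M ≤ q → q ≤ N → q ∈ J) :
    (A * B).coeff n = ∑ m ∈ I, ∑ q ∈ J,
      A.coeff m * powCoeff (D : Module.End F V) m (n - q) (B.coeff q) := by
  rw [coeff_mul, finsum_eq_sum_of_support_subset (s := I ×ˢ J), Finset.sum_product]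
  · rfl
  · intro t ht
    by_contra h
    refine ht (mulTerm_eq_zero A B hM hN n t fun h' => h ?_)
    simp only [Finset.coe_product, Set.mem_prod, Finset.mem_coe]
    exact ⟨hI _ (by omega) (by omega), hJ _ (by omega) (by omega)⟩

protected theorem mul_assoc (A B C : PseudoDiffOp D) : A * B * C = A * (B * C) := by
  obtain ⟨M, hM⟩ := A.exists_bound
  obtain ⟨N, hN⟩ := B.exists_bound
  obtain ⟨P, hP⟩ := C.exists_bound
  have hMN : ∀ n, M + N < n → (A * B).coeff n = 0 := fun n hn => by
    rw [coeff_mul, finsum_congr (fun t => mulTerm_eq_zero A B hM hN n t (by omega)), finsum_zero]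
  have hNP : ∀ n, N + P < n → (B * C).coeff n = 0 := fun n hn => by
    rw [coeff_mul, finsum_congr (fun t => mulTerm_eq_zero B C hN hP n t (by omega)), finsum_zero]
  ext n
  rw [coeff_mul_eq_sum (A * B) C hMN hP n (Finset.Icc (n - P) (M + N)) (Finset.Icc (n - M - N) P)
      (fun s _ _ => Finset.mem_Icc.2 (by omega)) (fun s _ _ => Finset.mem_Icc.2 (by omega)),
    coeff_mul_eq_sum A (B * C) hM hNP n (Finset.Icc (n - N - P) M) (Finset.Icc (n - M) (N + P))
      (fun s _ _ => Finset.mem_Icc.2 (by omega)) (fun s _ _ => Finset.mem_Icc.2 (by omega))]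
  have eL : ∀ s ∈ Finset.Icc (n - P) (M + N), (A * B).coeff s =
      ∑ m ∈ Finset.Icc (n - N - P) M, ∑ q ∈ Finset.Icc (n - M - P) N,
        A.coeff m * powCoeff (D : Module.End F V) m (s - q) (B.coeff q) := fun s hs => by
    rw [Finset.mem_Icc] at hs
    exact coeff_mul_eq_sum A B hM hN s _ _ (fun s _ _ => Finset.mem_Icc.2 (by omega))
      (fun s _ _ => Finset.mem_Icc.2 (by omega))
  have eR : ∀ r ∈ Finset.Icc (n - M) (N + P), (B * C).coeff r =
      ∑ q ∈ Finset.Icc (n - M - P) N, ∑ p ∈ Finset.Icc (n - M - N) P,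
        B.coeff q * powCoeff (D : Module.End F V) q (r - p) (C.coeff p) := fun r hr => by
    rw [Finset.mem_Icc] at hr
    exact coeff_mul_eq_sum B C hN hP r _ _ (fun s _ _ => Finset.mem_Icc.2 (by omega))
      (fun s _ _ => Finset.mem_Icc.2 (by omega))
  have key : ∀ m ∈ Finset.Icc (n - N - P) M, ∀ q ∈ Finset.Icc (n - M - P) N,
      ∀ p ∈ Finset.Icc (n - M - N) P,
      ∑ s ∈ Finset.Icc (n - P) (M + N), powCoeff (D : Module.End F V) m (s - q) (B.coeff q) *
          powCoeff (D : Module.End F V) s (n - p) (C.coeff p) =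
        ∑ r ∈ Finset.Icc (n - M) (N + P), powCoeff (D : Module.End F V) m (n - r)
          (B.coeff q * powCoeff (D : Module.End F V) q (r - p) (C.coeff p)) := by
    intro m hm q hq p hp
    rw [Finset.mem_Icc] at hm hq hp
    exact powCoeff_assoc D m q p n _ _ _ _ (fun s _ _ => Finset.mem_Icc.2 (by omega))
      (fun s _ _ => Finset.mem_Icc.2 (by omega))
  calc
    _ = ∑ s ∈ Finset.Icc (n - P) (M + N), ∑ p ∈ Finset.Icc (n - M - N) P,
        ∑ m ∈ Finset.Icc (n - N - P) M, ∑ q ∈ Finset.Icc (n - M - P) N,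
          A.coeff m * (powCoeff (D : Module.End F V) m (s - q) (B.coeff q) *
            powCoeff (D : Module.End F V) s (n - p) (C.coeff p)) := by
      refine Finset.sum_congr rfl fun s hs => Finset.sum_congr rfl fun p _ => ?_
      simp only [eL s hs, Finset.sum_mul, mul_assoc]
    _ = ∑ m ∈ Finset.Icc (n - N - P) M, ∑ q ∈ Finset.Icc (n - M - P) N,
        ∑ p ∈ Finset.Icc (n - M - N) P, A.coeff m * ∑ s ∈ Finset.Icc (n - P) (M + N),
          (powCoeff (D : Module.End F V) m (s - q) (B.coeff q) *
            powCoeff (D : Module.End F V) s (n - p) (C.coeff p)) := by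
      simp only [Finset.mul_sum]
      rw [Finset.sum_comm]
      simp_rw [Finset.sum_comm (s := Finset.Icc (n - P) (M + N))]
      rw [Finset.sum_comm]
      exact Finset.sum_congr rfl fun m _ => Finset.sum_comm
    _ = ∑ m ∈ Finset.Icc (n - N - P) M, ∑ q ∈ Finset.Icc (n - M - P) N,
        ∑ p ∈ Finset.Icc (n - M - N) P, A.coeff m * ∑ r ∈ Finset.Icc (n - M) (N + P),
          powCoeff (D : Module.End F V) m (n - r)
            (B.coeff q * powCoeff (D : Module.End F V) q (r - p) (C.coeff p)) :=
      Finset.sum_congr rfl fun m hm => Finset.sum_congr rfl fun q hq =>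
        Finset.sum_congr rfl fun p hp => by rw [key m hm q hq p hp]
    _ = _ := by
      refine Finset.sum_congr rfl fun m _ => ?_
      simp only [Finset.mul_sum]
      simp_rw [Finset.sum_comm (t := Finset.Icc (n - M) (N + P))]
      refine Finset.sum_congr rfl fun r hr => ?_
      simp only [eR r hr, map_sum, Finset.mul_sum]

protected theorem add_mul (A B C : PseudoDiffOp D) : (A + B) * C = A * C + B * C := by
  ext n
  rw [coeff_add, coeff_mul, coeff_mul, coeff_mul,
    ← finsum_add_distrib (mulTerm_finite A C n) (mulTerm_finite B C n)]
  exact finsum_congr fun t => by simp [mulTerm, add_mul]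

protected theorem mul_add (A B C : PseudoDiffOp D) : A * (B + C) = A * B + A * C := by
  ext n
  rw [coeff_add, coeff_mul, coeff_mul, coeff_mul,
    ← finsum_add_distrib (mulTerm_finite A B n) (mulTerm_finite A C n)]
  exact finsum_congr fun t => by simp [mulTerm, mul_add]

protected theorem one_mul (A : PseudoDiffOp D) : 1 * A = A := by
  ext n
  rw [coeff_mul, finsum_eq_single _ ((0 : ℤ), n)]
  · simp [mulTerm, coeff_one, powCoeff]
  · rintro ⟨m, q⟩ h
    by_cases hm : m = 0
    · subst hm
      have hq : q ≠ n := fun e => h (by rw [e])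
      by_cases hlt : 0 < n - q
      · simp [mulTerm, powCoeff_of_lt _ _ _ hlt]
      · obtain ⟨k, hk⟩ : ∃ k : ℕ, q - n = k + 1 := ⟨(q - n - 1).toNat, by omega⟩
        simp [mulTerm, powCoeff_sub _ 0 (n - q) (k + 1) (by push_cast; omega),
          Ring.choose_zero_succ]
    · simp [mulTerm, coeff_one, hm]

protected theorem mul_one (A : PseudoDiffOp D) : A * 1 = A := by
  ext n
  rw [coeff_mul, finsum_eq_single _ (n, (0 : ℤ))]
  · simp [mulTerm, coeff_one, powCoeff]
  · rintro ⟨m, q⟩ h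
    by_cases hq : q = 0
    · subst hq
      have hm : m ≠ n := fun e => h (by rw [e])
      by_cases hlt : m < n
      · simp [mulTerm, powCoeff_of_lt _ _ _ hlt]
      · obtain ⟨k, hk⟩ : ∃ k : ℕ, m - n = k + 1 := ⟨(m - n - 1).toNat, by omega⟩
        simp [mulTerm, powCoeff_sub _ m n (k + 1) (by push_cast; omega),
          coeff_one, pow_succ]
    · simp [mulTerm, coeff_one, hq]

/-- The associative algebra `V((∂⁻¹))`, as a ring. -/
noncomputable instance : Ring (PseudoDiffOp D) :=
  { (inferInstance : AddCommGroup (PseudoDiffOp D)) with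
    mul := (· * ·)
    one := 1
    mul_assoc := PseudoDiffOp.mul_assoc
    one_mul := PseudoDiffOp.one_mul
    mul_one := PseudoDiffOp.mul_one
    left_distrib := PseudoDiffOp.mul_add
    right_distrib := PseudoDiffOp.add_mul
    zero_mul := fun A => by
      have h := PseudoDiffOp.add_mul (0 : PseudoDiffOp D) 0 A
      rw [add_zero] at h
      exact left_eq_add.1 h
    mul_zero := fun A => by
      have h := PseudoDiffOp.mul_add A (0 : PseudoDiffOp D) 0
      rw [add_zero] at h
      exact left_eq_add.1 h }

/-- The differential part `A_+ = ∑ n ≥ 0, a_n ∂ ^ n`. -/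
def pos (A : PseudoDiffOp D) : PseudoDiffOp D :=
  ⟨fun n => if 0 ≤ n then A.coeff n else 0, by
    obtain ⟨M, hM⟩ := A.exists_bound
    exact ⟨M, fun n hn => by simp [hM n hn]⟩⟩

end PseudoDiffOp

/-! ### Lambda-brackets -/

section LambdaBracket

variable {F : Type*} [Field F] {V : Type*} [CommRing V] [Algebra F V]

/-- The operator `λ + ∂` on `V[λ]`: the variable `λ` is `X`, and `∂` acts on coefficients. -/
noncomputable def lambdaAdd (D : Derivation F V V) : Module.End F V[X] :=
  LinearMap.mulLeft F (X : V[X]) +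
    (PolynomialModule.equivPolynomialSelf.compDer D.mapCoeffs : Derivation F V[X] V[X])

theorem coeff_lambdaAdd (D : Derivation F V V) (p : V[X]) (n : ℕ) :
    (lambdaAdd D p).coeff n = (X * p).coeff n + D (p.coeff n) := rfl

/-- `p(λ + x) (|_{x = ∂} b) = ∑ n, p_n (λ + ∂) ^ n b` for `p = ∑ n, p_n λ ^ n` in `V[λ]`. -/
noncomputable def shiftApply (D : Derivation F V V) (p : V[X]) (b : V) : V[X] :=
  p.sum fun n c => C c * (lambdaAdd D ^ n) (C b)

/-- `(|_{x = ∂} p(-λ - x)) = ∑ n, (-λ - ∂) ^ n p_n` for `p = ∑ n, p_n λ ^ n` in `V[λ]`. -/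
noncomputable def negShift (D : Derivation F V V) (p : V[X]) : V[X] :=
  p.sum fun n c => ((-lambdaAdd D) ^ n) (C c)

theorem shiftApply_add (D : Derivation F V V) (p q : V[X]) (b : V) :
    shiftApply D (p + q) b = shiftApply D p b + shiftApply D q b :=
  sum_add_index p q _ (fun _ => by simp) (fun _ _ _ => by rw [C_add, add_mul])

theorem shiftApply_smul (D : Derivation F V V) (e : F) (p : V[X]) (b : V) :
    shiftApply D (e • p) b = e • shiftApply D p b := by
  rw [← algebraMap_smul V e p, shiftApply, sum_smul_index p _ _ (fun _ => by simp), shiftApply,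
    Polynomial.sum, Polynomial.sum, Finset.smul_sum]
  refine Finset.sum_congr rfl fun n _ => ?_
  rw [C_mul, mul_assoc, ← smul_eq_C_mul, algebraMap_smul]

/-- A `λ`-bracket on the differential algebra `(V, D)` over `F`: an `F`-bilinear map
`{a_λ b}` with values in `V[λ]`, satisfying sesquilinearity and the Leibniz rules.
Neither skewsymmetry nor the Jacobi identity is required. -/
structure LambdaBracket (D : Derivation F V V) where
  /-- `br a b` is `{a_λ b}`. -/
  br : V →ₗ[F] V →ₗ[F] V[X]
  sesq_left : ∀ a b, br (D a) b = -(X * br a b)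
  sesq_right : ∀ a b, br a (D b) = lambdaAdd D (br a b)
  leibniz_right : ∀ a b c, br a (b * c) = C c * br a b + C b * br a c
  leibniz_left : ∀ a b c, br (a * b) c = shiftApply D (br a c) b + shiftApply D (br b c) a

namespace LambdaBracket

variable {D : Derivation F V V}

/-- The pencil `{· _λ ·}_ε = {· _λ ·}_0 + ε {· _λ ·}_1`. -/
noncomputable def pencil (L₀ L₁ : LambdaBracket D) (ε : F) : LambdaBracket D where
  br := L₀.br + ε • L₁.br
  sesq_left a b := by
    simp only [LinearMap.add_apply, LinearMap.smul_apply, sesq_left, mul_add, mul_smul_comm,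
      smul_neg, neg_add]
  sesq_right a b := by
    simp only [LinearMap.add_apply, LinearMap.smul_apply, sesq_right, map_add, map_smul]
  leibniz_right a b c := by
    simp only [LinearMap.add_apply, LinearMap.smul_apply, leibniz_right, mul_add, mul_smul_comm,
      smul_add]
    abel
  leibniz_left a b c := by
    simp only [LinearMap.add_apply, LinearMap.smul_apply, leibniz_left, shiftApply_add,
      shiftApply_smul, smul_add]
    abel

end LambdaBracket

/-- The space `V / ∂V` of local functionals. -/
abbrev LocalFunctional (D : Derivation F V V) : Type _ := V ⧸ LinearMap.range (D : V →ₗ[F] V)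

/-- The quotient map `∫ : V → V / ∂V`. -/
def integralMap (D : Derivation F V V) : V →ₗ[F] LocalFunctional D :=
  (LinearMap.range (D : V →ₗ[F] V)).mkQ

namespace LambdaBracket

variable {D : Derivation F V V}

/-- The action `{∫f, g} = {f_λ g}|_{λ = 0}` of `V / ∂V` on `V`. -/
noncomputable def action (L : LambdaBracket D) : LocalFunctional D →ₗ[F] V →ₗ[F] V :=
  (LinearMap.range (D : V →ₗ[F] V)).liftQ
    (L.br.compr₂ ((lcoeff V 0).restrictScalars F)) (by
      rintro _ ⟨a, rfl⟩
      rw [LinearMap.mem_ker]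
      ext b
      simp [L.sesq_left])

@[simp] theorem action_integral (L : LambdaBracket D) (f g : V) :
    L.action (integralMap D f) g = (L.br f g).coeff 0 := rfl

/-- The bracket `{∫f, ∫g} = ∫{f_λ g}|_{λ = 0}` on `V / ∂V`. -/
noncomputable def functionalBracket (L : LambdaBracket D) (f : LocalFunctional D) :
    LocalFunctional D →ₗ[F] LocalFunctional D :=
  Submodule.mapQ _ _ (L.action f) (by
    rintro _ ⟨b, rfl⟩
    obtain ⟨a, rfl⟩ := Submodule.mkQ_surjective _ f
    refine ⟨(L.br a b).coeff 0, ?_⟩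
    change D ((L.br a b).coeff 0) = (L.br a (D b)).coeff 0
    rw [L.sesq_right, coeff_lambdaAdd]
    simp)

@[simp] theorem functionalBracket_integral (L : LambdaBracket D) (f g : V) :
    L.functionalBracket (integralMap D f) (integralMap D g) = integralMap D ((L.br f g).coeff 0) := rfl

/-- The subalgebra `S` of `V` (stable under `∂` in the applications) is a Poisson vertex algebra
with the restriction of the `λ`-bracket: the bracket of two elements of `S` lies in `S[λ]`, and
skewsymmetry and the Jacobi identity hold on `S`. The Jacobi identity
`{a_λ {b_μ c}} - {b_μ {a_λ c}} = {{a_λ b}_{λ+μ} c}` is written in `V[λ][μ]`. -/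
structure IsPVAOn (L : LambdaBracket D) (S : Subalgebra F V) : Prop where
  closed : ∀ a ∈ S, ∀ b ∈ S, ∀ n, (L.br a b).coeff n ∈ S
  skew : ∀ a ∈ S, ∀ b ∈ S, L.br b a = -negShift D (L.br a b)
  jacobi : ∀ a ∈ S, ∀ b ∈ S, ∀ c ∈ S,
    ((L.br b c).sum fun n r => C (L.br a r) * (X : V[X][X]) ^ n) -
      ((L.br a c).sum fun n r => (L.br b r).map C * C (X ^ n)) =
    (L.br a b).sum fun n r => C (X ^ n) * (L.br r c).eval₂ (C.comp C) (C X + X)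

/-- `S` is a bi-Poisson vertex algebra: every member of the pencil makes it a PVA. -/
def IsBiPVAOn (L₀ L₁ : LambdaBracket D) (S : Subalgebra F V) : Prop :=
  ∀ ε : F, (pencil L₀ L₁ ε).IsPVAOn S

end LambdaBracket

/-! ### Operators of Adler type -/

variable {D : Derivation F V V}

/-- For scalar symbols `P(z) = ∑ b_q z ^ q` and `Q(z) = ∑ a_p z ^ p`, the coefficient of
`z ^ m w ^ n` in
`P(w + λ + ∂) ι_z (z - w - λ - ∂)⁻¹ Q^*(λ - z) - P(z) ι_z (z - w - λ - ∂)⁻¹ Q(w)`.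
Here `ι_z (z - w - λ - ∂)⁻¹ = ∑ k ≥ 0, z ^ (-k - 1) (w + λ + ∂) ^ k` and
`Q^*(λ - z) = ∑ p, (z - λ - ∂) ^ p a_p` (expanded for large `z`), so that the two terms are
`∑ k p q, b_q z ^ (-k - 1) (w + λ + ∂) ^ (q + k) (z - λ - ∂) ^ p a_p` and
`∑ k p q, b_q z ^ (q - k - 1) (w + λ + ∂) ^ k a_p w ^ p`. Both sums have finitely many non-zero
contributions to each coefficient. -/
noncomputable def adlerCoeff (P Q : PseudoDiffOp D) (m n : ℤ) : V[X] :=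
  (∑ᶠ t : ℕ × ℤ × ℤ, C (P.coeff t.2.2) *
    powCoeff (lambdaAdd D) (t.2.2 + t.1) n
      (powCoeff (-lambdaAdd D) t.2.1 (m + t.1 + 1) (C (Q.coeff t.2.1)))) -
  ∑ᶠ t : ℕ × ℤ, C (P.coeff (m + t.1 + 1)) *
    powCoeff (lambdaAdd D) t.1 (n - t.2) (C (Q.coeff t.2))

/-- The matrix pseudodifferential operator `A` is of Adler type with respect to the `λ`-bracket:
the Adler identity for `{A_{ij}(z)_λ A_{hk}(w)}`, compared at every `z ^ m w ^ n`. -/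
def IsAdlerType (L : LambdaBracket D) {M N : ℕ}
    (A : Matrix (Fin M) (Fin N) (PseudoDiffOp D)) : Prop :=
  ∀ (i : Fin M) (j : Fin N) (h : Fin M) (k : Fin N) (m n : ℤ),
    L.br ((A i j).coeff m) ((A h k).coeff n) = adlerCoeff (A h j) (A i k) m n

/-- `A` is of bi-Adler type: for every `ε` in `F` the operator `A + ε 1_N` is of Adler type with
respect to `{· _λ ·}_0 + ε {· _λ ·}_1`. -/
def IsBiAdlerType (L₀ L₁ : LambdaBracket D) {N : ℕ}
    (A : Matrix (Fin N) (Fin N) (PseudoDiffOp D)) : Prop :=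
  ∀ ε : F, IsAdlerType (L₀.pencil L₁ ε)
    (A + Matrix.diagonal fun _ => PseudoDiffOp.const D (algebraMap F V ε))

/-- The differential subalgebra of `V` generated by the coefficients of the entries of `A`. -/
def coeffSubalgebra {N : ℕ} (A : Matrix (Fin N) (Fin N) (PseudoDiffOp D)) : Subalgebra F V :=
  Algebra.adjoin F {v | ∃ i j m, ∃ r : ℕ, v = D^[r] ((A i j).coeff m)}

/-- `B` is a `K`-th root of the invertible matrix operator `A`, where `K` is a non-zero integer.
Every matrix `B` with `B ^ K = A` is itself invertible, so `B` is taken among the units. -/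
def IsOperatorRoot {N : ℕ} (A B : (Matrix (Fin N) (Fin N) (PseudoDiffOp D))ˣ) (K : ℤ) : Prop :=
  K ≠ 0 ∧ B ^ K = A

/-- `h_{n,B} = -(K / n) Res_z tr (B ^ n)(z)` for `n ≠ 0`, and `h_{0,B} = 0`. -/
noncomputable def hDensity {N : ℕ} (K : ℤ) (B : (Matrix (Fin N) (Fin N) (PseudoDiffOp D))ˣ)
    (n : ℤ) : V :=
  if n = 0 then 0
  else (-(K : F) / (n : F)) •
    (Matrix.trace ((B ^ n : (Matrix (Fin N) (Fin N) (PseudoDiffOp D))ˣ) :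
      Matrix (Fin N) (Fin N) (PseudoDiffOp D))).coeff (-1)

/-- The commutator `[(B ^ n)_+, A]`. -/
noncomputable def laxCommutator {N : ℕ} (A B : (Matrix (Fin N) (Fin N) (PseudoDiffOp D))ˣ)
    (n : ℤ) : Matrix (Fin N) (Fin N) (PseudoDiffOp D) :=
  ⁅((B ^ n : (Matrix (Fin N) (Fin N) (PseudoDiffOp D))ˣ) :
      Matrix (Fin N) (Fin N) (PseudoDiffOp D)).map PseudoDiffOp.pos,
    (A : Matrix (Fin N) (Fin N) (PseudoDiffOp D))⁆

end LambdaBracket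

/-!
Pairing the Adler identity with a test function turns it into a statement about derivations: each
coefficient of `A`, weighted by a function, generates a derivation acting on `A` by the Adler
vector field `δ_x A = A (x A)_+ - (A x)_+ A`, where `x` is a matrix unit. Only three properties of
the ring of matrix pseudodifferential operators are then needed: `A ↦ A_+` is a Rota–Baxter
operator, `∫ Res tr` is a trace, and `∫ Res tr (A_+ B) = ∫ Res tr (A (B - B_+))`. Skewsymmetry and
the Jacobi identity on the coefficients of `A` become trace identities for Adler vector fields, and
extend to the generated differential subalgebra because the bracket is a derivation of it. To read
them off from integrals one takes the weights to be differential indeterminates adjoined to `V`,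
for which `∫ X f = 0` forces `f = 0`.

For a root `B ^ K = A` every derivation satisfies `K tr δ(B ^ n) = n tr (B ^ (n - K) δA)`. On the
Adler vector field of `A`, and on its linear part in the shift `A ↦ A + ε`, the right-hand side
gives the same commutator `[(B ^ n)_+, A]`, which is the recurrence. A Lax equation `δA = [P, A]`
preserves `∫ Res tr C ^ n` for every root `C`, since `C` commutes with `A`; hence the involution.
-/

section PowCoeff

variable {F : Type*} [Field F] {M M' : Type*} [AddCommGroup M] [Module F M]
  [AddCommGroup M'] [Module F M']

theorem map_powCoeff (f : M →ₗ[F] M') {T : Module.End F M} {T' : Module.End F M'}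
    (h : ∀ x, f (T x) = T' (f x)) (q s : ℤ) (x : M) :
    f (powCoeff T q s x) = powCoeff T' q s (f x) := by
  have hpow (n : ℕ) : f ((T ^ n) x) = (T' ^ n) (f x) := by
    simpa only [Module.End.coe_pow] using Function.Semiconj.iterate_right h n x
  unfold powCoeff
  split_ifs <;> simp [hpow]

theorem powCoeff_apply_of_map_eq_zero {T : Module.End F M} {x : M} (hx : T x = 0) (q s : ℤ) :
    powCoeff T q s x = if s = q then x else 0 := by
  rcases lt_trichotomy s q with h | rfl | h
  · obtain ⟨k, rfl⟩ : ∃ k : ℕ, s = q - (k + 1 : ℕ) := ⟨(q - s - 1).toNat, by omega⟩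
    rw [powCoeff_sub T q _ (k + 1) rfl, if_neg (by omega)]
    simp [pow_succ, hx]
  · simp [powCoeff]
  · simp [powCoeff_of_lt T q s h, h.ne']

theorem powCoeff_of_nonneg_of_neg (T : Module.End F M) {q s : ℤ} (hq : 0 ≤ q) (hs : s < 0) :
    powCoeff T q s = 0 := by
  lift q to ℕ using hq
  rw [powCoeff_sub T q s (q - s).toNat (by omega), Ring.choose_natCast,
    Nat.choose_eq_zero_of_lt (by omega), Nat.cast_zero, zero_smul]

theorem powCoeff_zero_left (T : Module.End F M) (s : ℤ) :
    powCoeff T 0 s = if s = 0 then 1 else 0 := by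
  rcases lt_trichotomy s 0 with h | rfl | h
  · rw [powCoeff_of_nonneg_of_neg T le_rfl h, if_neg h.ne]
  · simp [powCoeff]
  · rw [powCoeff_of_lt T 0 s h, if_neg h.ne']

theorem neg_one_pow_mul_choose_neg (a : ℤ) (n : ℕ) :
    (-1) ^ n * Ring.choose (-a) n = Ring.choose (a + n - 1) n := by
  rw [Ring.choose_neg, Int.negOnePow, Units.smul_def, smul_eq_mul, ← mul_assoc]
  simp [← mul_pow]

theorem neg_pow_eq_zsmul (T : Module.End F M) (n : ℕ) : (-T) ^ n = (-1 : ℤ) ^ n • T ^ n := by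
  rw [neg_pow, zsmul_eq_mul]
  simp

open Finset.HasAntidiagonal (antidiagonal mem_antidiagonal)

theorem choose_natCast_add_sub (p r : ℤ) (s : ℕ) :
    Ring.choose (s + r - p) s =
      ∑ ij ∈ antidiagonal s, Ring.choose (r + ij.1) ij.1 * ((-1) ^ ij.2 * Ring.choose p ij.2) := by
  rw [show s + r - p = (r + 1 - p) + s - 1 by ring, ← neg_one_pow_mul_choose_neg,
    show -(r + 1 - p) = -(r + 1) + p by ring, Ring.add_choose_eq s (Commute.all _ _),
    Finset.mul_sum]
  refine Finset.sum_congr rfl fun ij hij => ?_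
  rw [show r + ij.1 = (r + 1) + ij.1 - 1 by ring, ← neg_one_pow_mul_choose_neg,
    ← mem_antidiagonal.1 hij, pow_add]
  ring

/-- Chu–Vandermonde, as it is needed for the differential part of `∂ ^ (-1 - m) ∘ x ∂ ^ p`. -/
theorem powCoeff_neg_one_sub (T : Module.End F M) (m p : ℤ) {r : ℤ} (hr : 0 ≤ r) (K : ℕ)
    (hK : p - m ≤ K) (x : M) :
    powCoeff T (-1 - m) (r - p) x =
      ∑ k ∈ Finset.range K, powCoeff T k r (powCoeff (-T) p (m + k + 1) x) := by
  lift r to ℕ using hr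
  have hzero (k : ℕ) (hk : (k : ℤ) < r ∨ p < m + k + 1) :
      powCoeff T k r (powCoeff (-T) p (m + k + 1) x) = 0 := by
    rcases hk with hk | hk
    · simp [powCoeff_of_lt T _ _ hk]
    · simp [powCoeff_of_lt (-T) _ _ hk]
  by_cases hs : -1 - m < r - p
  · rw [powCoeff_of_lt _ _ _ hs, Finset.sum_eq_zero fun k _ => hzero k (by omega),
      LinearMap.zero_apply]
  obtain ⟨s, hs⟩ := Int.le.dest (not_lt.1 hs)
  have hterm (ij : ℕ × ℕ) (hij : ij ∈ antidiagonal s) :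
      (Ring.choose ((r : ℤ) + ij.1) ij.1 * ((-1) ^ ij.2 * Ring.choose p ij.2)) • (T ^ s) x =
        powCoeff T (r + ij.1 : ℕ) r (powCoeff (-T) p (m + (r + ij.1 : ℕ) + 1) x) := by
    have hij := mem_antidiagonal.1 hij
    rw [powCoeff_sub T _ r ij.1 (by push_cast; ring),
      powCoeff_sub (-T) p _ ij.2 (by push_cast; omega), neg_pow_eq_zsmul, ← hij, pow_add]
    simp only [LinearMap.smul_apply, map_zsmul, Module.End.mul_apply, smul_smul]
    push_cast
    congr 1
    ring
  rw [powCoeff_sub T _ _ s (by omega), show -1 - m = s + r - p by omega, choose_natCast_add_sub,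
    LinearMap.smul_apply, Finset.sum_smul, Finset.sum_congr rfl hterm]
  refine Finset.sum_of_injOn (fun ij => r + ij.1) ?_ ?_ ?_ fun _ _ => rfl
  · rintro ⟨i, j⟩ hij ⟨i', j'⟩ hij' h
    simp only [Finset.mem_coe, mem_antidiagonal] at hij hij' h
    ext <;> simp only <;> omega
  · rintro ⟨i, j⟩ hij
    simp only [Finset.mem_coe, mem_antidiagonal, Finset.mem_range] at hij ⊢
    omega
  · refine fun k _ hk => hzero k ?_
    by_contra! h
    refine hk ⟨(k - r, s - (k - r)), ?_, ?_⟩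
    · simp only [Finset.mem_coe, mem_antidiagonal]
      omega
    · simp only
      omega

end PowCoeff

namespace PseudoDiffOp

variable {F : Type*} [Field F] {V : Type*} [CommRing V] [Algebra F V] {D : Derivation F V V}

@[simp] theorem coeff_sub (A B : PseudoDiffOp D) (n : ℤ) :
    (A - B).coeff n = A.coeff n - B.coeff n := rfl

@[simp] theorem coeff_const (a : V) (n : ℤ) : (const D a).coeff n = if n = 0 then a else 0 := rfl

@[simp] theorem coeff_pos (A : PseudoDiffOp D) (n : ℤ) :
    A.pos.coeff n = if 0 ≤ n then A.coeff n else 0 := rfl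

/-- Extraction of the coefficient of `∂ ^ n`, as an additive map. -/
def coeffHom (D : Derivation F V V) (n : ℤ) : PseudoDiffOp D →+ V where
  toFun A := A.coeff n
  map_zero' := rfl
  map_add' _ _ := rfl

@[simp] theorem coeff_sum {ι : Type*} (s : Finset ι) (f : ι → PseudoDiffOp D) (n : ℤ) :
    (∑ i ∈ s, f i).coeff n = ∑ i ∈ s, (f i).coeff n :=
  map_sum (coeffHom D n) f s

/-- The operator `∂ ^ n`. -/
def dpow (D : Derivation F V V) (n : ℤ) : PseudoDiffOp D :=
  ⟨fun m => if m = n then 1 else 0, n, fun m hm => by simp [hm.ne']⟩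

@[simp] theorem coeff_dpow (m n : ℤ) : (dpow D m).coeff n = if n = m then 1 else 0 := rfl

theorem coeff_mul_of_left {A : PseudoDiffOp D} {m : ℤ} (hA : ∀ p, p ≠ m → A.coeff p = 0)
    (B : PseudoDiffOp D) (n : ℤ) :
    (A * B).coeff n =
      ∑ᶠ q, A.coeff m * powCoeff (D : Module.End F V) m (n - q) (B.coeff q) := by
  rw [coeff_mul, finsum_curry _ (mulTerm_finite A B n), finsum_eq_single _ m]
  · rfl
  · intro p hp
    simp [mulTerm, hA p hp]

theorem coeff_mul_of_right {B : PseudoDiffOp D} {m : ℤ} (hB : ∀ q, q ≠ m → B.coeff q = 0)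
    (A : PseudoDiffOp D) (n : ℤ) :
    (A * B).coeff n =
      ∑ᶠ p, A.coeff p * powCoeff (D : Module.End F V) p (n - m) (B.coeff m) := by
  rw [coeff_mul, finsum_curry _ (mulTerm_finite A B n)]
  refine finsum_congr fun p => finsum_eq_single _ m fun q hq => ?_
  simp [mulTerm, hB q hq]

theorem coeff_mul_dpow (A : PseudoDiffOp D) (m n : ℤ) :
    (A * dpow D m).coeff n = A.coeff (n - m) := by
  rw [coeff_mul_of_right (m := m) fun q hq => if_neg hq, coeff_dpow, if_pos rfl]
  simp only [powCoeff_apply_of_map_eq_zero (T := (D : Module.End F V)) (x := 1) (by simp), mul_ite,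
    mul_one, mul_zero]
  rw [finsum_eq_single _ (n - m) fun p hp => if_neg hp.symm, if_pos rfl]

theorem coeff_const_mul (a : V) (A : PseudoDiffOp D) (n : ℤ) :
    (const D a * A).coeff n = a * A.coeff n := by
  rw [coeff_mul_of_left (m := 0) fun q hq => if_neg hq, finsum_eq_single _ n]
  · simp [powCoeff_zero_left]
  · intro q hq
    simp [powCoeff_zero_left, sub_ne_zero.2 hq.symm]

theorem coeff_dpow_mul (m : ℤ) (A : PseudoDiffOp D) (n : ℤ) :
    (dpow D m * A).coeff n = ∑ᶠ q, powCoeff (D : Module.End F V) m (n - q) (A.coeff q) := by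
  simp [coeff_mul_of_left (A := dpow D m) fun _ hq => if_neg hq]

theorem coeff_dpow_mul_const (m n : ℤ) (a : V) :
    (dpow D m * const D a).coeff n = powCoeff (D : Module.End F V) m n a := by
  rw [coeff_dpow_mul, finsum_eq_single _ 0 fun q hq => by simp [hq]]
  simp

theorem coeff_mul_const (A : PseudoDiffOp D) (a : V) (n : ℤ) :
    (A * const D a).coeff n = ∑ᶠ p, A.coeff p * powCoeff (D : Module.End F V) p n a := by
  simp [coeff_mul_of_right (B := const D a) fun _ hq => if_neg hq]

theorem coeff_mul_dpow_mul_const (A : PseudoDiffOp D) (k : ℤ) (a : V) (n : ℤ) :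
    (A * (dpow D k * const D a)).coeff n =
      ∑ᶠ p, A.coeff p * powCoeff (D : Module.End F V) (p + k) n a := by
  rw [← mul_assoc, coeff_mul_const, ← finsum_comp_equiv (Equiv.addRight k)]
  simp [coeff_mul_dpow]

theorem const_zero : const D 0 = 0 := by
  ext n
  simp

/-- The map `A ↦ A_+`, as an additive map. -/
def posHom (D : Derivation F V V) : PseudoDiffOp D →+ PseudoDiffOp D where
  toFun := pos
  map_zero' := by ext n; simp
  map_add' A B := by ext n; simp only [coeff_pos, coeff_add]; split_ifs <;> simp

theorem posHom_apply (A : PseudoDiffOp D) : posHom D A = A.pos := rfl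

theorem pos_mul_pos (A B : PseudoDiffOp D) : (A.pos * B.pos).pos = A.pos * B.pos := by
  ext n
  rw [coeff_pos]
  refine ite_eq_left_iff.2 fun hn => ((finsum_congr fun t => ?_).trans finsum_zero).symm
  by_cases hp : 0 ≤ t.1
  · by_cases hq : 0 ≤ t.2
    · simp [mulTerm, powCoeff_of_nonneg_of_neg (D : Module.End F V) hp
        (show n - t.2 < 0 by omega)]
    · simp [mulTerm, hq]
  · simp [mulTerm, hp]

theorem coeff_sub_pos_mul_sub_pos (A B : PseudoDiffOp D) {n : ℤ} (hn : -2 < n) :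
    ((A - A.pos) * (B - B.pos)).coeff n = 0 := by
  refine (finsum_congr fun t => mulTerm_eq_zero _ _ (M := -1) (N := -1) ?_ ?_ n t ?_).trans
    finsum_zero
  · exact fun m hm => by simp [show 0 ≤ m by omega]
  · exact fun m hm => by simp [show 0 ≤ m by omega]
  · omega

theorem pos_mul_const (A : PseudoDiffOp D) (a : V) : (A * const D a).pos = A.pos * const D a := by
  ext n
  rw [coeff_pos, coeff_mul_const, coeff_mul_const]
  have hneg {p : ℤ} (hp : 0 ≤ p) (hn : n < 0) : powCoeff (D : Module.End F V) p n a = 0 := by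
    rw [powCoeff_of_nonneg_of_neg _ hp hn, LinearMap.zero_apply]
  have hlt {p : ℤ} (hp : p < n) : powCoeff (D : Module.End F V) p n a = 0 := by
    rw [powCoeff_of_lt _ p n hp, LinearMap.zero_apply]
  split_ifs with hn
  · refine finsum_congr fun p => ?_
    by_cases hp : 0 ≤ p
    · rw [coeff_pos, if_pos hp]
    · rw [hlt (by omega), mul_zero, mul_zero]
  · refine ((finsum_congr fun p => ?_).trans finsum_zero).symm
    by_cases hp : 0 ≤ p
    · rw [hneg hp (by omega), mul_zero]
    · rw [coeff_pos, if_neg hp, zero_mul]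

section MapCoeff

variable {W : Type*} [CommRing W] [Algebra F W] {E : Derivation F W W}

/-- Application of a linear map to all coefficients. -/
def mapCoeff (E : Derivation F W W) (f : V →ₗ[F] W) : PseudoDiffOp D →+ PseudoDiffOp E where
  toFun A := ⟨fun n => f (A.coeff n), by
    obtain ⟨M, hM⟩ := A.exists_bound
    exact ⟨M, fun n hn => by rw [hM n hn, map_zero]⟩⟩
  map_zero' := PseudoDiffOp.ext (funext fun _ => map_zero f)
  map_add' _ _ := PseudoDiffOp.ext (funext fun _ => map_add f _ _)

@[simp] theorem coeff_mapCoeff (f : V →ₗ[F] W) (A : PseudoDiffOp D) (n : ℤ) :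
    (mapCoeff E f A).coeff n = f (A.coeff n) := rfl

theorem mapCoeff_pos (f : V →ₗ[F] W) (A : PseudoDiffOp D) :
    mapCoeff E f A.pos = (mapCoeff E f A).pos := by
  ext n
  simp only [coeff_mapCoeff, coeff_pos, apply_ite f, map_zero]

theorem mapCoeff_const (f : V →ₗ[F] W) (a : V) :
    mapCoeff E f (const D a) = const E (f a) := by
  ext n
  simp only [coeff_mapCoeff, coeff_const, apply_ite f, map_zero]

theorem mapCoeff_dpow_of_map_one_eq_zero {f : V →ₗ[F] W} (hf : f 1 = 0) (m : ℤ) :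
    mapCoeff E f (dpow D m) = 0 := by
  ext n
  simp only [coeff_mapCoeff, coeff_dpow, apply_ite f, hf, map_zero, ite_self, coeff_zero]

variable [Algebra V W] [IsScalarTower F V W]

theorem algebraMap_powCoeff (hE : ∀ v, E (algebraMap V W v) = algebraMap V W (D v)) (q s : ℤ)
    (v : V) : algebraMap V W (powCoeff (D : Module.End F V) q s v) =
      powCoeff (E : Module.End F W) q s (algebraMap V W v) :=
  map_powCoeff (IsScalarTower.toAlgHom F V W).toLinearMap (fun v => (hE v).symm) q s v

/-- The homomorphism of operator algebras induced by an extension `V → W` of differential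
algebras. -/
noncomputable def map (hE : ∀ v, E (algebraMap V W v) = algebraMap V W (D v)) :
    PseudoDiffOp D →+* PseudoDiffOp E where
  __ := mapCoeff E (IsScalarTower.toAlgHom F V W).toLinearMap
  map_one' := by
    refine (mapCoeff_const _ 1).trans ?_
    rw [AlgHom.toLinearMap_apply, map_one]
    rfl
  map_mul' A B := by
    ext n
    refine ((IsScalarTower.toAlgHom F V W : V →+ W).map_finsum (mulTerm_finite A B n)).trans
      (finsum_congr fun t => (map_mul (algebraMap V W) _ _).trans ?_)
    exact congrArg _ (algebraMap_powCoeff hE _ _ _)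

@[simp] theorem coeff_map (hE : ∀ v, E (algebraMap V W v) = algebraMap V W (D v))
    (A : PseudoDiffOp D) (n : ℤ) : (map hE A).coeff n = algebraMap V W (A.coeff n) := rfl

theorem mapCoeff_derivation_mul (hE : ∀ v, E (algebraMap V W v) = algebraMap V W (D v))
    {δ : Derivation F V W} (hδ : ∀ v, δ (D v) = E (δ v)) (A B : PseudoDiffOp D) :
    mapCoeff E (δ : V →ₗ[F] W) (A * B) =
      mapCoeff E δ A * map hE B + map hE A * mapCoeff E δ B := by
  ext n
  rw [coeff_add, coeff_mul, coeff_mul,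
    ← finsum_add_distrib (mulTerm_finite _ _ n) (mulTerm_finite _ _ n)]
  refine ((δ : V →ₗ[F] W).toAddMonoidHom.map_finsum (mulTerm_finite A B n)).trans
    (finsum_congr fun t => (δ.leibniz _ _).trans ?_)
  have hpow (v : V) : δ (powCoeff (D : Module.End F V) t.1 (n - t.2) v) =
      powCoeff (E : Module.End F W) t.1 (n - t.2) (δ v) :=
    map_powCoeff (δ : V →ₗ[F] W) hδ _ _ v
  simp only [mulTerm, hpow, algebraMap_powCoeff hE, Algebra.smul_def, coeff_mapCoeff, coeff_map,
    Derivation.coeFn_coe]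
  ring

end MapCoeff

end PseudoDiffOp

section Residue

variable {F : Type*} [Field F] {V : Type*} [CommRing V] [Algebra F V] {D : Derivation F V V}

theorem integralMap_mul_derivation_pow (k : ℕ) (a b : V) :
    integralMap D (a * ((D : Module.End F V) ^ k) b) =
      integralMap D (b * ((-(D : Module.End F V)) ^ k) a) := by
  have hparts (a b : V) : integralMap D (a * D b) = integralMap D (b * -D a) := by
    rw [← sub_eq_zero, ← map_sub]
    refine (Submodule.Quotient.mk_eq_zero _).2 ⟨a * b, ?_⟩
    simp only [Derivation.coeFn_coe, Derivation.leibniz, smul_eq_mul]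
    ring
  induction k generalizing a b with
  | zero => simp [mul_comm]
  | succ k ih =>
    calc integralMap D (a * ((D : Module.End F V) ^ (k + 1)) b)
        = integralMap D (a * D (((D : Module.End F V) ^ k) b)) := by rw [pow_succ']; rfl
      _ = integralMap D (b * ((-(D : Module.End F V)) ^ k) (-D a)) := by
        rw [hparts, mul_comm, ih]
      _ = integralMap D (b * ((-(D : Module.End F V)) ^ (k + 1)) a) := by rw [pow_succ]; rfl

theorem integralMap_mul_powCoeff (a b : V) (m q : ℤ) :
    integralMap D (a * powCoeff (D : Module.End F V) m (-1 - q) b) =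
      integralMap D (b * powCoeff (D : Module.End F V) q (-1 - m) a) := by
  by_cases h : m < -1 - q
  · simp [powCoeff_of_lt _ _ _ h, powCoeff_of_lt _ q (-1 - m) (by omega)]
  obtain ⟨s, hs⟩ := Int.le.dest (not_lt.1 h)
  have hchoose := neg_one_pow_mul_choose_neg (-q) s
  rw [neg_neg, show -q + s - 1 = m by omega] at hchoose
  rw [powCoeff_sub _ m _ s (by omega), powCoeff_sub _ q _ s (by omega), ← hchoose]
  simp only [LinearMap.smul_apply, mul_smul_comm, map_zsmul]
  rw [integralMap_mul_derivation_pow, neg_pow_eq_zsmul, LinearMap.smul_apply, mul_smul_comm,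
    map_zsmul, smul_smul, mul_right_comm, ← mul_pow, neg_one_mul, neg_neg, one_pow, one_mul]

namespace PseudoDiffOp

theorem integralMap_residue_mul_comm (A B : PseudoDiffOp D) :
    integralMap D ((A * B).coeff (-1)) = integralMap D ((B * A).coeff (-1)) := by
  obtain ⟨M, hM⟩ := A.exists_bound
  obtain ⟨N, hN⟩ := B.exists_bound
  rw [coeff_mul_eq_sum A B hM hN (-1) (Finset.Icc (-1 - N) M) (Finset.Icc (-1 - M) N)
      (fun s _ _ => Finset.mem_Icc.2 (by omega)) (fun s _ _ => Finset.mem_Icc.2 (by omega)),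
    coeff_mul_eq_sum B A hN hM (-1) (Finset.Icc (-1 - M) N) (Finset.Icc (-1 - N) M)
      (fun s _ _ => Finset.mem_Icc.2 (by omega)) (fun s _ _ => Finset.mem_Icc.2 (by omega)),
    Finset.sum_comm]
  simp only [map_sum, integralMap_mul_powCoeff]

end PseudoDiffOp

end Residue

/-- A Rota–Baxter operator `pos` of weight `-1` on a ring with a trace for which `1 - pos` is
adjoint to `pos`. The example of interest is `pos A = A_+` on pseudodifferential operators, with
the trace `∫ Res`. -/
structure TracedRotaBaxter (R G : Type*) [Ring R] [AddCommGroup G] where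
  pos : R →+ R
  tr : R →+ G
  pos_mul_pos : ∀ x y, pos x * pos y = pos (pos x * y + x * pos y - x * y)
  tr_mul_comm : ∀ x y, tr (x * y) = tr (y * x)
  tr_pos_mul : ∀ x y, tr (pos x * y) = tr (x * (y - pos y))

namespace TracedRotaBaxter

section Ring

variable {R G : Type*} [Ring R] [AddCommGroup G] (S : TracedRotaBaxter R G)

theorem tr_pos_mul_add_tr_pos_mul (x y : R) :
    S.tr (S.pos x * y) + S.tr (S.pos y * x) = S.tr (x * y) := by
  rw [S.tr_pos_mul, S.tr_mul_comm (S.pos y), ← map_add, ← mul_add, sub_add_cancel]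

/-- The Adler map `A (x B)_+ - (A x)_+ B`, polarised in `A`. -/
def adler (A B x : R) : R := A * S.pos (x * B) - S.pos (A * x) * B

theorem tr_adler_mul (A B x y : R) :
    S.tr (S.adler A B x * y) =
      S.tr (S.pos (x * B) * (y * A)) - S.tr (S.pos (A * x) * (B * y)) := by
  rw [adler, sub_mul, map_sub, mul_assoc A, S.tr_mul_comm A, mul_assoc, mul_assoc]

theorem tr_adler_skew (A B x y : R) :
    S.tr (S.adler A B x * y) = -S.tr (S.adler B A y * x) := by
  have hleft := S.tr_pos_mul_add_tr_pos_mul (x * B) (y * A)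
  have hright := S.tr_pos_mul_add_tr_pos_mul (A * x) (B * y)
  have hcyclic : S.tr (x * B * (y * A)) = S.tr (A * x * (B * y)) := by
    rw [mul_assoc A, S.tr_mul_comm A]
    simp only [mul_assoc]
  rw [tr_adler_mul, tr_adler_mul]
  linear_combination (norm := abel) hleft - hright + hcyclic

/-- The element `[x, y]_A` such that the Adler vector fields `δ_x A = A (x A)_+ - (A x)_+ A`
satisfy `[δ_x, δ_y] = δ_{[x, y]_A}`. -/
def adlerComm (A x y : R) : R :=
  S.pos (x * A) * y + (y * A - S.pos (y * A)) * x - x * (A * y - S.pos (A * y)) -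
    y * S.pos (A * x)

/-- The second variation `δ_x δ_y A` along two Adler vector fields. -/
def adlerVariation (A x y : R) : R :=
  S.adler (S.adler A A x) A y + S.adler A (S.adler A A x) y

theorem adlerVariation_sub_comm (A x y : R) :
    S.adlerVariation A x y - S.adlerVariation A y x = S.adler A A (S.adlerComm A x y) := by
  have hleft : S.pos (x * A) * S.pos (y * A) - S.pos (y * A) * S.pos (x * A) +
      S.pos (y * S.adler A A x) - S.pos (x * S.adler A A y) =
      S.pos (S.adlerComm A x y * A) := by
    rw [S.pos_mul_pos, S.pos_mul_pos]
    simp only [← map_sub, ← map_add]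
    congr 1
    simp only [adler, adlerComm]
    noncomm_ring
  have hright : S.pos (S.adler A A x * y) - S.pos (A * y) * S.pos (A * x) -
      S.pos (S.adler A A y * x) + S.pos (A * x) * S.pos (A * y) =
      S.pos (A * S.adlerComm A x y) := by
    rw [S.pos_mul_pos, S.pos_mul_pos]
    simp only [← map_sub, ← map_add]
    congr 1
    simp only [adler, adlerComm]
    noncomm_ring
  rw [show S.adler A A (S.adlerComm A x y) = A * S.pos (S.adlerComm A x y * A) -
      S.pos (A * S.adlerComm A x y) * A from rfl, ← hleft, ← hright]
  simp only [adlerVariation, adler]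
  noncomm_ring

theorem tr_adlerVariation_skew (A x y w : R) :
    S.tr (S.adlerVariation A x y * w) = -S.tr (S.adlerVariation A x w * y) := by
  simp only [adlerVariation, add_mul, map_add]
  rw [S.tr_adler_skew _ A y w, S.tr_adler_skew A _ y w]
  abel

theorem tr_adlerVariation_mul (A x y w : R) :
    S.tr (S.adlerVariation A w x * y) = S.tr (S.adler A A w * S.adlerComm A x y) := by
  rw [adlerVariation]
  generalize S.adler A A w = B
  have hcomm : S.tr (B * S.adlerComm A x y) =
      S.tr (y * B * S.pos (x * A)) + S.tr (x * B * (y * A - S.pos (y * A))) -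
        S.tr (B * x * (A * y - S.pos (A * y))) - S.tr (B * y * S.pos (A * x)) := by
    rw [adlerComm, mul_sub, mul_sub, mul_add, map_sub, map_sub, map_add, ← mul_assoc B x,
      ← mul_assoc B y, ← mul_assoc B, S.tr_mul_comm _ y, ← mul_assoc B, S.tr_mul_comm _ x,
      mul_assoc y, mul_assoc x]
  rw [add_mul, map_add, tr_adler_mul, tr_adler_mul, hcomm, ← S.tr_pos_mul, ← S.tr_pos_mul,
    S.tr_mul_comm (y * B), S.tr_mul_comm (B * y)]
  abel

theorem tr_adlerVariation_cyclic (A x y w : R) :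
    S.tr (S.adlerVariation A x y * w) + S.tr (S.adlerVariation A y w * x) +
      S.tr (S.adlerVariation A w x * y) = 0 := by
  rw [S.tr_adlerVariation_skew A y w x, ← sub_eq_add_neg, ← map_sub, ← sub_mul,
    adlerVariation_sub_comm, S.tr_adlerVariation_mul, S.tr_adler_skew, neg_add_cancel]

theorem tr_adler_mul_of_commute {A g : R} (hg : Commute g A) (y : R) :
    S.tr (S.adler A A y * g) = S.tr (⁅S.pos (g * A), A⁆ * y) := by
  rw [tr_adler_skew, tr_adler_mul, ← hg.eq, neg_sub, Ring.lie_def, sub_mul, map_sub,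
    mul_assoc A, S.tr_mul_comm A]
  simp only [mul_assoc]

theorem tr_adler_one_mul_of_commute {A g : R} (hg : Commute g A) (y : R) :
    S.tr ((S.adler A 1 y + S.adler 1 A y) * g) = S.tr (⁅S.pos g, A⁆ * y) := by
  have hleft := S.tr_pos_mul_add_tr_pos_mul g (y * A)
  have hright := S.tr_pos_mul_add_tr_pos_mul g (A * y)
  have hcyclic : S.tr (g * (y * A)) = S.tr (g * (A * y)) := by
    rw [← mul_assoc, S.tr_mul_comm, ← mul_assoc, ← hg.eq, mul_assoc]
  rw [add_mul, map_add, tr_adler_mul, tr_adler_mul, hg.eq, Ring.lie_def, sub_mul, map_sub,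
    mul_assoc A, S.tr_mul_comm A]
  simp only [mul_assoc, one_mul, mul_one]
  linear_combination (norm := abel) hleft - hright + hcyclic

theorem tr_mul_lie_of_commute {A g : R} (hg : Commute g A) (x : R) :
    S.tr (g * ⁅x, A⁆) = 0 := by
  rw [Ring.lie_def, mul_sub, ← mul_assoc, ← mul_assoc, map_sub, S.tr_mul_comm (g * x),
    ← mul_assoc, hg.eq, sub_self]

end Ring

section Matrix

variable {R G : Type*} [Ring R] [AddCommGroup G] {ι : Type*} [Fintype ι] [DecidableEq ι]

/-- Matrices over a ring with a traced Rota–Baxter operator: `pos` acts entrywise, and the trace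
is that of the sum of the diagonal entries. -/
def matrix (S : TracedRotaBaxter R G) : TracedRotaBaxter (Matrix ι ι R) G where
  pos := S.pos.mapMatrix
  tr := S.tr.comp (Matrix.traceAddMonoidHom ι R)
  pos_mul_pos x y := by
    ext i j
    simp only [AddMonoidHom.mapMatrix_apply, Matrix.mul_apply, Matrix.map_apply, Matrix.sub_apply,
      Matrix.add_apply, S.pos_mul_pos, map_sum, map_add, map_sub, Finset.sum_add_distrib,
      Finset.sum_sub_distrib]
  tr_mul_comm x y := by
    simp only [AddMonoidHom.comp_apply, Matrix.traceAddMonoidHom_apply, Matrix.trace,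
      Matrix.diag_apply, Matrix.mul_apply, map_sum]
    rw [Finset.sum_comm]
    exact Finset.sum_congr rfl fun i _ => Finset.sum_congr rfl fun j _ => S.tr_mul_comm _ _
  tr_pos_mul x y := by
    simp only [AddMonoidHom.comp_apply, AddMonoidHom.mapMatrix_apply,
      Matrix.traceAddMonoidHom_apply, Matrix.trace, Matrix.diag_apply, Matrix.mul_apply, map_sum,
      Matrix.map_apply, Matrix.sub_apply, S.tr_pos_mul]

theorem matrix_pos_apply (S : TracedRotaBaxter R G) (x : Matrix ι ι R) :
    S.matrix.pos x = x.map S.pos := rfl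

theorem matrix_tr_apply (S : TracedRotaBaxter R G) (x : Matrix ι ι R) :
    S.matrix.tr x = S.tr x.trace := rfl

theorem tr_mul_single (S : TracedRotaBaxter R G) (x : Matrix ι ι R) (i j : ι) (a : R) :
    S.matrix.tr (x * Matrix.single i j a) = S.tr (x j i * a) := by
  rw [matrix_tr_apply, Matrix.trace_mul_single]
  rfl

theorem adler_single_apply (S : TracedRotaBaxter R G) (x y : Matrix ι ι R) (i j h k : ι) (a : R) :
    S.matrix.adler x y (Matrix.single j i a) h k =
      x h j * S.pos (a * y i k) - S.pos (x h j * a) * y i k := by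
  rw [adler, Matrix.sub_apply, matrix_pos_apply, matrix_pos_apply, Matrix.mul_apply,
    Matrix.mul_apply, Finset.sum_eq_single j, Finset.sum_eq_single i]
  · simp
  · intro l _ hl
    simp [Matrix.mul_single_apply_of_ne _ _ _ _ _ hl]
  · simp
  · intro l _ hl
    simp [Matrix.single_mul_apply_of_ne _ _ _ _ _ hl]
  · simp

end Matrix

end TracedRotaBaxter

/-- The Rota–Baxter operator `A ↦ A_+` on `V((∂⁻¹))`, with the trace `∫ Res`. -/
noncomputable def PseudoDiffOp.tracedRotaBaxter {F : Type*} [Field F] {V : Type*} [CommRing V]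
    [Algebra F V] (D : Derivation F V V) :
    TracedRotaBaxter (PseudoDiffOp D) (LocalFunctional D) where
  pos := posHom D
  tr := (integralMap D : V →+ LocalFunctional D).comp (coeffHom D (-1))
  pos_mul_pos A B := by
    have hneg : ((A - A.pos) * (B - B.pos)).pos = 0 := by
      ext n
      rw [coeff_pos, coeff_zero]
      exact ite_eq_right_iff.2 fun hn => coeff_sub_pos_mul_sub_pos A B (by omega)
    rw [posHom_apply, posHom_apply, ← pos_mul_pos, ← posHom_apply (A.pos * B.pos), ← sub_eq_zero,
      ← map_sub, posHom_apply, ← hneg]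
    congr 1
    noncomm_ring
  tr_mul_comm := integralMap_residue_mul_comm
  tr_pos_mul A B := by
    have hpos : (A.pos * B.pos).coeff (-1) = 0 := by
      rw [← pos_mul_pos, coeff_pos, if_neg (by omega)]
    have hneg : ((A - A.pos) * (B - B.pos)).coeff (-1) = 0 :=
      coeff_sub_pos_mul_sub_pos A B (by omega)
    rw [sub_mul, coeff_sub, sub_eq_zero, mul_sub A.pos, coeff_sub, hpos, sub_zero] at hneg
    exact congrArg (integralMap D) hneg.symm

section LogarithmicDerivative

variable {R R' G : Type*} [Ring R] [Ring R'] [AddCommGroup G] (T : R' →+ G)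
  (hT : ∀ x y, T (x * y) = T (y * x)) (ψ : R →+* R') (δ : R →+ R')
  (hδ : ∀ x y, δ (x * y) = δ x * ψ y + ψ x * δ y)

include hT hδ in
theorem trace_inv_mul_derivation_mul {g : R} (B : Rˣ) {C : Rˣ} (hg : Commute (C : R) g) :
    T (ψ (g * ↑(B * C)⁻¹) * δ ↑(B * C)) =
      T (ψ (g * ↑B⁻¹) * δ B) + T (ψ (g * ↑C⁻¹) * δ C) := by
  have hleft : T (ψ (g * ↑(B * C)⁻¹) * (δ B * ψ C)) = T (ψ (g * ↑B⁻¹) * δ B) := by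
    rw [← mul_assoc, hT, ← mul_assoc, ← map_mul, mul_inv_rev, Units.val_mul, ← mul_assoc,
      ← mul_assoc, hg.eq, mul_assoc g, Units.mul_inv, mul_one]
  have hright : ψ (g * ↑(B * C)⁻¹) * (ψ B * δ C) = ψ (g * ↑C⁻¹) * δ C := by
    rw [← mul_assoc, ← map_mul, mul_inv_rev, Units.val_mul, mul_assoc, mul_assoc,
      Units.inv_mul, mul_one]
  rw [Units.val_mul, hδ, mul_add, map_add, hright, ← hleft]

include hT hδ in
theorem trace_inv_mul_derivation_zpow {g : R} {B : Rˣ} (hg : Commute (B : R) g) (n : ℤ) :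
    T (ψ (g * ↑(B ^ n)⁻¹) * δ ↑(B ^ n)) = n • T (ψ (g * ↑B⁻¹) * δ B) := by
  let f : ℤ →+ G := AddMonoidHom.mk' (fun n => T (ψ (g * ↑(B ^ n)⁻¹) * δ ↑(B ^ n))) fun m n => by
    rw [zpow_add]
    exact trace_inv_mul_derivation_mul T hT ψ δ hδ _ (hg.units_zpow_left n)
  simpa [f] using map_zsmul f n 1

include hT hδ in
theorem zsmul_trace_derivation_zpow (B : Rˣ) (n K : ℤ) :
    K • T (δ ↑(B ^ n)) = n • T (ψ ↑(B ^ (n - K)) * δ ↑(B ^ K)) := by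
  have hlog (m : ℤ) : T (ψ ↑(B ^ (n - m)) * δ ↑(B ^ m)) = m • T (ψ (↑(B ^ n) * ↑B⁻¹) * δ B) := by
    have hcomm : Commute (B : R) ↑(B ^ n) := (Commute.refl (B : R)).units_zpow_right n
    rw [← trace_inv_mul_derivation_zpow T hT ψ δ hδ hcomm, zpow_sub, Units.val_mul]
  have hn := hlog n
  rw [sub_self, zpow_zero, Units.val_one, map_one, one_mul] at hn
  rw [hn, hlog, smul_comm]

end LogarithmicDerivative

/-! ### Symbols acting on functions -/

section SymbolAction

variable {F : Type*} [Field F] {V : Type*} [CommRing V] {W : Type*} [CommRing W] [Algebra F W]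
  [Algebra V W] {E : Derivation F W W}

variable (E) in
/-- `p(∂) f = ∑ n, p_n ∂ ^ n f`, for a symbol `p` over `V` and an element `f` of a differential
algebra over `V`. -/
noncomputable def symbolApply (f : W) : V[X] →ₗ[V] W :=
  Polynomial.lsum fun n => LinearMap.toSpanSingleton V W (((E : Module.End F W) ^ n) f)

theorem symbolApply_monomial (f : W) (n : ℕ) (c : V) :
    symbolApply E f (monomial n c) = c • ((E : Module.End F W) ^ n) f := by
  simp [symbolApply, Polynomial.lsum_apply]

theorem symbolApply_C (f : W) (c : V) : symbolApply E f (C c) = c • f := by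
  rw [← monomial_zero_left, symbolApply_monomial, pow_zero, Module.End.one_apply]

theorem symbolApply_C_mul (f : W) (c : V) (p : V[X]) :
    symbolApply E f (C c * p) = c • symbolApply E f p := by
  rw [← smul_eq_C_mul, map_smul]

variable [Algebra F V] {D : Derivation F V V}

theorem derivation_smul (hE : ∀ v, E (algebraMap V W v) = algebraMap V W (D v)) (v : V)
    (f : W) : E (v • f) = v • E f + D v • f := by
  rw [Algebra.smul_def, E.leibniz, hE, smul_eq_mul, smul_eq_mul, mul_comm f, Algebra.smul_def,
    Algebra.smul_def]

theorem lambdaAdd_monomial (D : Derivation F V V) (n : ℕ) (a : V) :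
    lambdaAdd D (monomial n a) = monomial (n + 1) a + monomial n (D a) := by
  ext k
  rw [coeff_lambdaAdd, X_mul_monomial, coeff_add]
  congr 1
  simp only [coeff_monomial, apply_ite D, map_zero]

theorem symbolApply_lambdaAdd
    (hE : ∀ v, E (algebraMap V W v) = algebraMap V W (D v)) (f : W) (p : V[X]) :
    symbolApply E f (lambdaAdd D p) = E (symbolApply E f p) := by
  induction p using Polynomial.induction_on' with
  | add p q hp hq => rw [map_add, map_add, map_add, hp, hq, map_add]
  | monomial n a =>
    rw [lambdaAdd_monomial, map_add, symbolApply_monomial, symbolApply_monomial,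
      symbolApply_monomial, derivation_smul hE, pow_succ']
    rfl

variable [IsScalarTower F V W]

variable (E) in
/-- The adjoint action `p(∂)^* f = ∑ n, (-∂) ^ n (p_n f)`. -/
noncomputable def symbolCoapply (f : W) : V[X] →ₗ[F] W :=
  Polynomial.lsum fun n =>
    ((-(E : Module.End F W)) ^ n) ∘ₗ (LinearMap.toSpanSingleton V W f).restrictScalars F

theorem symbolCoapply_monomial (f : W) (n : ℕ) (c : V) :
    symbolCoapply E f (monomial n c) = ((-(E : Module.End F W)) ^ n) (c • f) := by
  simp [symbolCoapply, Polynomial.lsum_apply]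

theorem symbolCoapply_C (f : W) (c : V) : symbolCoapply E f (C c) = c • f := by
  rw [← monomial_zero_left, symbolCoapply_monomial, pow_zero, Module.End.one_apply]

theorem symbolCoapply_C_mul (f : W) (c : V) (p : V[X]) :
    symbolCoapply E f (C c * p) = symbolCoapply E (c • f) p := by
  induction p using Polynomial.induction_on' with
  | add p q hp hq => rw [mul_add, map_add, map_add, hp, hq]
  | monomial n a =>
    rw [C_mul_monomial, symbolCoapply_monomial, symbolCoapply_monomial, mul_comm, mul_smul]

theorem symbolCoapply_X_mul (f : W) (p : V[X]) :
    symbolCoapply E f (X * p) = -E (symbolCoapply E f p) := by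
  induction p using Polynomial.induction_on' with
  | add p q hp hq => rw [mul_add, map_add, map_add, hp, hq, map_add, neg_add]
  | monomial n a =>
    rw [X_mul_monomial, symbolCoapply_monomial, symbolCoapply_monomial, pow_succ']
    rfl

theorem negShift_add (p q : V[X]) : negShift D (p + q) = negShift D p + negShift D q :=
  sum_add_index p q _ (fun _ => by simp) fun _ _ _ => by rw [C_add, map_add]

variable (hE : ∀ v, E (algebraMap V W v) = algebraMap V W (D v))

include hE

theorem symbolCoapply_lambdaAdd (f : W) (p : V[X]) :
    symbolCoapply E f (lambdaAdd D p) = symbolCoapply E (-E f) p := by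
  induction p using Polynomial.induction_on' with
  | add p q hp hq => rw [map_add, map_add, map_add, hp, hq]
  | monomial n a =>
    rw [lambdaAdd_monomial, map_add, symbolCoapply_monomial, symbolCoapply_monomial,
      symbolCoapply_monomial, pow_succ, Module.End.mul_apply, ← map_add]
    congr 1
    rw [LinearMap.neg_apply, Derivation.coeFn_coe, derivation_smul hE, smul_neg]
    abel

theorem symbolCoapply_shiftApply (f : W) (p : V[X]) (b : V) :
    symbolCoapply E f (shiftApply D p b) = b • symbolCoapply E f p := by
  have hpow (n : ℕ) (g : W) : symbolCoapply E g ((lambdaAdd D ^ n) (C b)) =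
      b • ((-(E : Module.End F W)) ^ n) g := by
    induction n generalizing g with
    | zero => simp [symbolCoapply_C]
    | succ n ih =>
      rw [pow_succ', Module.End.mul_apply, symbolCoapply_lambdaAdd hE, ih, pow_succ]
      rfl
  induction p using Polynomial.induction_on' with
  | add p q hp hq => rw [shiftApply_add, map_add, map_add, hp, hq, smul_add]
  | monomial n a =>
    rw [shiftApply, sum_monomial_index _ _ (by simp), symbolCoapply_C_mul, hpow,
      symbolCoapply_monomial]

theorem symbolApply_negShift (f : W) (p : V[X]) :
    symbolApply E f (negShift D p) = symbolCoapply E f p := by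
  have hpow (n : ℕ) (q : V[X]) : symbolApply E f (((-lambdaAdd D) ^ n) q) =
      ((-(E : Module.End F W)) ^ n) (symbolApply E f q) := by
    induction n generalizing q with
    | zero => simp
    | succ n ih =>
      rw [pow_succ, Module.End.mul_apply, ih, pow_succ, Module.End.mul_apply, LinearMap.neg_apply,
        map_neg, symbolApply_lambdaAdd hE]
      rfl
  induction p using Polynomial.induction_on' with
  | add p q hp hq => rw [negShift_add, map_add, map_add, hp, hq]
  | monomial n a =>
    rw [negShift, sum_monomial_index _ _ (by simp), hpow, symbolApply_C, symbolCoapply_monomial]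

omit hE

theorem integralMap_mul_symbolApply (f g : W) (p : V[X]) :
    integralMap E (g * symbolApply E f p) = integralMap E (f * symbolCoapply E g p) := by
  induction p using Polynomial.induction_on' with
  | add p q hp hq => simp only [map_add, mul_add, hp, hq]
  | monomial n a =>
    rw [symbolApply_monomial, symbolCoapply_monomial, mul_smul_comm, ← smul_mul_assoc,
      integralMap_mul_derivation_pow]

theorem integralMap_symbolCoapply (f : W) (p : V[X]) :
    integralMap E (symbolCoapply E f p) = integralMap E (p.coeff 0 • f) := by
  have hone : symbolApply E 1 p = algebraMap V W (p.coeff 0) := by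
    induction p using Polynomial.induction_on' with
    | add p q hp hq => rw [map_add, coeff_add, map_add, hp, hq]
    | monomial n a =>
      rw [symbolApply_monomial, Algebra.smul_def]
      cases n <;> simp [pow_succ]
  rw [← one_mul (symbolCoapply E f p), ← integralMap_mul_symbolApply, hone, Algebra.smul_def,
    mul_comm]

end SymbolAction

namespace PseudoDiffOp

variable {F : Type*} [Field F] {V : Type*} [CommRing V] [Algebra F V] {D : Derivation F V V}

theorem finsum_eq_sum_Icc {G : Type*} [AddCommMonoid G] {f : ℤ → G} {a b : ℤ}
    (hf : ∀ q, ¬(a ≤ q ∧ q ≤ b) → f q = 0) : ∑ᶠ q, f q = ∑ q ∈ Finset.Icc a b, f q :=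
  finsum_eq_sum_of_support_subset _ fun q hq => by
    rw [Finset.coe_Icc]
    exact not_not.1 fun h => hq (hf q h)

theorem pos_dpow_mul_const_mul (Q : PseudoDiffOp D) (f : V) (m : ℤ) {N : ℤ}
    (hN : ∀ n, N < n → Q.coeff n = 0) (K : ℕ) (hK : N - m ≤ K) :
    (dpow D (-1 - m) * const D f * Q).pos =
      ∑ k ∈ Finset.range K, ∑ p ∈ Finset.Icc (m + 1) N, dpow D k *
        const D (powCoeff (-(D : Module.End F V)) p (m + k + 1) (Q.coeff p * f)) := by
  ext r
  simp only [coeff_sum, coeff_dpow_mul_const, coeff_pos]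
  split_ifs with hr
  · rw [mul_assoc, coeff_dpow_mul, finsum_eq_sum_Icc (a := m + 1) (b := N), Finset.sum_comm]
    · refine Finset.sum_congr rfl fun p hp => ?_
      rw [Finset.mem_Icc] at hp
      rw [coeff_const_mul, mul_comm f]
      exact powCoeff_neg_one_sub _ m p hr K (by omega) _
    · intro p hp
      by_cases hpN : N < p
      · simp [coeff_const_mul, hN p hpN]
      · simp [powCoeff_of_lt (D : Module.End F V) (-1 - m) (r - p) (by omega)]
  · refine (Finset.sum_eq_zero fun k _ => Finset.sum_eq_zero fun p _ => ?_).symm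
    rw [powCoeff_of_nonneg_of_neg _ k.cast_nonneg (not_le.1 hr), LinearMap.zero_apply]

theorem pos_mul_dpow (P : PseudoDiffOp D) (m : ℤ) {M : ℤ}
    (hM : ∀ n, M < n → P.coeff n = 0) (K : ℕ) (hK : M - m ≤ K) :
    (P * dpow D (-1 - m)).pos =
      ∑ k ∈ Finset.range K, const D (P.coeff (m + k + 1)) * dpow D k := by
  ext r
  simp only [coeff_sum, coeff_const, coeff_pos, coeff_mul_dpow]
  split_ifs with hr
  · lift r to ℕ using hr
    simp only [sub_eq_zero, Nat.cast_inj, Finset.sum_ite_eq, Finset.mem_range]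
    split_ifs with hrK
    · congr 1
      ring
    · exact hM _ (by omega)
  · exact (Finset.sum_eq_zero fun k _ => if_neg (by omega)).symm

section AdlerCoeff

variable (P Q : PseudoDiffOp D) {M N : ℤ} (hM : ∀ n, M < n → P.coeff n = 0)
  (hN : ∀ n, N < n → Q.coeff n = 0) (m n : ℤ) (K : ℕ)

include hM hN

theorem adlerCoeff_eq_sum (hK : N - m ≤ K) (hK' : M - m ≤ K) :
    adlerCoeff P Q m n =
      (∑ k ∈ Finset.range K, ∑ p ∈ Finset.Icc (m + 1) N, ∑ q ∈ Finset.Icc (n - K) M,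
        C (P.coeff q) * powCoeff (lambdaAdd D) (q + k) n
          (powCoeff (-lambdaAdd D) p (m + k + 1) (C (Q.coeff p)))) -
      ∑ k ∈ Finset.range K, ∑ p ∈ Finset.Icc (n - K) N,
        C (P.coeff (m + k + 1)) * powCoeff (lambdaAdd D) k (n - p) (C (Q.coeff p)) := by
  simp only [← Finset.sum_product']
  refine congrArg₂ (· - ·) (finsum_eq_sum_of_support_subset _ ?_)
    (finsum_eq_sum_of_support_subset _ ?_)
  · rintro ⟨k, p, q⟩ ht
    by_contra hn
    refine ht ?_
    simp only [Finset.coe_product, Finset.coe_range, Finset.coe_Icc, Set.mem_prod, Set.mem_Iio,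
      Set.mem_Icc] at hn
    by_cases hq : M < q
    · simp [hM q hq]
    by_cases hp : N < p
    · simp [hN p hp]
    by_cases hmk : p < m + k + 1
    · simp [powCoeff_of_lt _ _ _ hmk]
    · simp [powCoeff_of_lt (lambdaAdd D) (q + k) n (by omega)]
  · rintro ⟨k, p⟩ ht
    by_contra hn
    refine ht ?_
    simp only [Finset.coe_product, Finset.coe_range, Finset.coe_Icc, Set.mem_prod, Set.mem_Iio,
      Set.mem_Icc] at hn
    by_cases hmk : M < m + k + 1
    · simp [hM _ hmk]
    by_cases hp : N < p
    · simp [hN p hp]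
    · simp [powCoeff_of_lt (lambdaAdd D) k (n - p) (by omega)]

theorem coeff_mul_pos_dpow_mul_const_mul (f : V) (hK : N - m ≤ K) :
    (P * (dpow D (-1 - m) * const D f * Q).pos).coeff n =
      ∑ k ∈ Finset.range K, ∑ p ∈ Finset.Icc (m + 1) N, ∑ q ∈ Finset.Icc (n - K) M,
        P.coeff q * powCoeff (D : Module.End F V) (q + k) n
          (powCoeff (-(D : Module.End F V)) p (m + k + 1) (Q.coeff p * f)) := by
  rw [pos_dpow_mul_const_mul Q f m hN K hK]
  simp only [Finset.mul_sum, coeff_sum]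
  refine Finset.sum_congr rfl fun k hk => Finset.sum_congr rfl fun p _ => ?_
  rw [Finset.mem_range] at hk
  rw [coeff_mul_dpow_mul_const, finsum_eq_sum_Icc]
  intro q hq
  by_cases hqM : M < q
  · simp [hM q hqM]
  · simp [powCoeff_of_lt (D : Module.End F V) (q + k) n (by omega)]

theorem coeff_pos_mul_dpow_mul_const_mul (f : V) (hK : M - m ≤ K) :
    ((P * (dpow D (-1 - m) * const D f)).pos * Q).coeff n =
      ∑ k ∈ Finset.range K, ∑ p ∈ Finset.Icc (n - K) N,
        P.coeff (m + k + 1) * powCoeff (D : Module.End F V) k (n - p) (Q.coeff p * f) := by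
  rw [← mul_assoc, pos_mul_const, pos_mul_dpow P m hM K hK, Finset.sum_mul, Finset.sum_mul]
  simp only [coeff_sum, mul_assoc, coeff_const_mul, coeff_dpow_mul, ← Finset.mul_sum, mul_comm f]
  refine Finset.sum_congr rfl fun k hk => congrArg _ (finsum_eq_sum_Icc fun p hp => ?_)
  rw [Finset.mem_range] at hk
  by_cases hpN : N < p
  · simp [hN p hpN]
  · simp [powCoeff_of_lt (D : Module.End F V) k (n - p) (by omega)]

end AdlerCoeff

variable {W : Type*} [CommRing W] [Algebra F W] [Algebra V W] [IsScalarTower F V W]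
  {E : Derivation F W W}

theorem symbolApply_powCoeff (hE : ∀ v, E (algebraMap V W v) = algebraMap V W (D v)) (f : W)
    (q s : ℤ) (x : V[X]) : symbolApply E f (powCoeff (lambdaAdd D) q s x) =
      powCoeff (E : Module.End F W) q s (symbolApply E f x) :=
  map_powCoeff ((symbolApply E f).restrictScalars F) (symbolApply_lambdaAdd hE f) q s x

theorem symbolApply_powCoeff_neg (hE : ∀ v, E (algebraMap V W v) = algebraMap V W (D v)) (f : W)
    (q s : ℤ) (x : V[X]) : symbolApply E f (powCoeff (-lambdaAdd D) q s x) =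
      powCoeff (-(E : Module.End F W)) q s (symbolApply E f x) :=
  map_powCoeff (T := -lambdaAdd D) (T' := -(E : Module.End F W))
    ((symbolApply E f).restrictScalars F)
    (fun x => by simp [LinearMap.neg_apply, symbolApply_lambdaAdd hE]) q s x

/-- Evaluated on a function `f`, the coefficients of the Adler identity become those of the Adler
map at the operator `∂ ^ (-1 - m) ∘ f`. -/
theorem symbolApply_adlerCoeff (hE : ∀ v, E (algebraMap V W v) = algebraMap V W (D v))
    (P Q : PseudoDiffOp D) (m n : ℤ) (f : W) :
    symbolApply E f (adlerCoeff P Q m n) =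
      (map hE P * (dpow E (-1 - m) * const E f * map hE Q).pos -
        (map hE P * (dpow E (-1 - m) * const E f)).pos * map hE Q).coeff n := by
  obtain ⟨M, hM⟩ := P.exists_bound
  obtain ⟨N, hN⟩ := Q.exists_bound
  have hM' : ∀ n, M < n → (map hE P).coeff n = 0 := fun n hn => by simp [hM n hn]
  have hN' : ∀ n, N < n → (map hE Q).coeff n = 0 := fun n hn => by simp [hN n hn]
  obtain ⟨K, hK, hK'⟩ : ∃ K : ℕ, N - m ≤ K ∧ M - m ≤ K :=
    ⟨max (N - m).toNat (M - m).toNat, by omega, by omega⟩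
  rw [adlerCoeff_eq_sum P Q hM hN m n K hK hK', coeff_sub,
    coeff_mul_pos_dpow_mul_const_mul _ _ hM' hN' m n K f hK,
    coeff_pos_mul_dpow_mul_const_mul _ _ hM' hN' m n K f hK']
  simp only [map_sub, map_sum, symbolApply_C_mul, symbolApply_powCoeff hE,
    symbolApply_powCoeff_neg hE, symbolApply_C, coeff_map,
    Algebra.smul_def]

end PseudoDiffOp

/-! ### Matrices of operators -/

namespace PseudoDiffOp

section Matrix

variable {F : Type*} [Field F] {V W : Type*} [CommRing V] [CommRing W] [Algebra F V]
  [Algebra F W] {D : Derivation F V V} {E : Derivation F W W} {ι : Type*}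

/-- The entrywise action of a derivation on the coefficients of a matrix operator. -/
noncomputable def matrixDer (E : Derivation F W W) [Module V W] (δ : Derivation F V W) :
    Matrix ι ι (PseudoDiffOp D) →+ Matrix ι ι (PseudoDiffOp E) :=
  (mapCoeff E (δ : V →ₗ[F] W)).mapMatrix

@[simp] theorem coeff_matrixDer [Module V W] (δ : Derivation F V W)
    (M : Matrix ι ι (PseudoDiffOp D)) (i j : ι) (n : ℤ) :
    (matrixDer E δ M i j).coeff n = δ ((M i j).coeff n) := rfl

variable [Fintype ι] [DecidableEq ι]

/-- The traced Rota–Baxter operator of `Mat (V((∂⁻¹)))`: the entrywise differential part, with the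
trace `∫ Res tr`. -/
noncomputable abbrev matrixRotaBaxter (ι : Type*) [Fintype ι] [DecidableEq ι]
    (D : Derivation F V V) :
    TracedRotaBaxter (Matrix ι ι (PseudoDiffOp D)) (LocalFunctional D) :=
  (tracedRotaBaxter D).matrix

/-- The operator `∂ ^ (-1 - n) ∘ g` placed at the entry `(k, h)`: its pairing with `M` under
`∫ Res tr` is `∫ g M_{hk,n}`. -/
noncomputable def testOp (D : Derivation F V V) (k h : ι) (n : ℤ) (g : V) :
    Matrix ι ι (PseudoDiffOp D) :=
  Matrix.single k h (dpow D (-1 - n) * const D g)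

theorem tr_mul_testOp (M : Matrix ι ι (PseudoDiffOp D)) (k h : ι) (n : ℤ) (g : V) :
    (matrixRotaBaxter ι D).tr (M * testOp D k h n g) = integralMap D (g * (M h k).coeff n) := by
  rw [testOp, TracedRotaBaxter.tr_mul_single, ← mul_assoc, (tracedRotaBaxter D).tr_mul_comm]
  change integralMap D ((const D g * (M h k * dpow D (-1 - n))).coeff (-1)) = _
  rw [coeff_const_mul, coeff_mul_dpow, sub_sub_cancel]

theorem matrixDer_pos [Module V W] (δ : Derivation F V W) (M : Matrix ι ι (PseudoDiffOp D)) :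
    matrixDer E δ ((matrixRotaBaxter ι D).pos M) =
      (matrixRotaBaxter ι E).pos (matrixDer E δ M) := by
  ext1 i j
  exact mapCoeff_pos _ _

theorem integralMap_derivation_trace [Module V W] (δ : Derivation F V W)
    (M : Matrix ι ι (PseudoDiffOp D)) :
    integralMap E (δ (M.trace.coeff (-1))) = (matrixRotaBaxter ι E).tr (matrixDer E δ M) := by
  rw [TracedRotaBaxter.matrix_tr_apply]
  change _ = integralMap E ((matrixDer E δ M).trace.coeff (-1))
  simp only [Matrix.trace, Matrix.diag_apply, coeff_sum, map_sum, coeff_matrixDer]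

variable [Algebra V W] [IsScalarTower F V W]
  (hE : ∀ v, E (algebraMap V W v) = algebraMap V W (D v))

variable (ι) in
/-- Matrix operators over `V` as matrix operators over a differential algebra over `V`. -/
noncomputable def matrixMap : Matrix ι ι (PseudoDiffOp D) →+* Matrix ι ι (PseudoDiffOp E) :=
  (map hE).mapMatrix

@[simp] theorem coeff_matrixMap (M : Matrix ι ι (PseudoDiffOp D)) (i j : ι) (n : ℤ) :
    (matrixMap ι hE M i j).coeff n = algebraMap V W ((M i j).coeff n) := rfl

theorem matrixMap_pos (M : Matrix ι ι (PseudoDiffOp D)) :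
    matrixMap ι hE ((matrixRotaBaxter ι D).pos M) =
      (matrixRotaBaxter ι E).pos (matrixMap ι hE M) := by
  ext1 i j
  exact mapCoeff_pos _ _

theorem matrixDer_mul (δ : Derivation F V W) (hδ : ∀ v, δ (D v) = E (δ v))
    (M M' : Matrix ι ι (PseudoDiffOp D)) :
    matrixDer E δ (M * M') =
      matrixDer E δ M * matrixMap ι hE M' + matrixMap ι hE M * matrixDer E δ M' := by
  ext1 i j
  change mapCoeff E (δ : V →ₗ[F] W) ((M * M') i j) = _
  simp only [Matrix.mul_apply, Matrix.add_apply, map_sum, mapCoeff_derivation_mul hE hδ,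
    Finset.sum_add_distrib]
  rfl

omit [Fintype ι] in
include hE in
theorem matrixDer_testOp (δ : Derivation F V W) (hδ : ∀ v, δ (D v) = E (δ v)) (k h : ι) (n : ℤ)
    {g : V} (hg : δ g = 0) : matrixDer E δ (testOp D k h n g) = 0 := by
  have hentry : mapCoeff E (δ : V →ₗ[F] W) (dpow D (-1 - n) * const D g) = 0 := by
    rw [mapCoeff_derivation_mul hE hδ, mapCoeff_dpow_of_map_one_eq_zero δ.map_one_eq_zero,
      mapCoeff_const, Derivation.coeFn_coe, hg, const_zero, zero_mul, mul_zero, add_zero]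
  ext1 i j
  change mapCoeff E (δ : V →ₗ[F] W) (Matrix.single k h _ i j) = 0
  rw [Matrix.single_apply]
  split_ifs
  · exact hentry
  · exact map_zero _

theorem matrixDer_adler (δ : Derivation F V W) (hδ : ∀ v, δ (D v) = E (δ v))
    (A B x : Matrix ι ι (PseudoDiffOp D)) (hx : matrixDer E δ x = 0) :
    matrixDer E δ ((matrixRotaBaxter ι D).adler A B x) =
      (matrixRotaBaxter ι E).adler (matrixDer E δ A) (matrixMap ι hE B) (matrixMap ι hE x) +
        (matrixRotaBaxter ι E).adler (matrixMap ι hE A) (matrixDer E δ B)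
          (matrixMap ι hE x) := by
  simp only [TracedRotaBaxter.adler, map_sub, matrixDer_mul hE δ hδ, matrixDer_pos, matrixMap_pos,
    map_mul, hx, zero_mul, mul_zero, zero_add, add_zero]
  abel

end Matrix

end PseudoDiffOp

/-! ### Differential polynomials -/

section Jets

variable {F : Type*} [Field F] {V : Type*} [CommRing V] [Algebra F V] {σ : Type*}

theorem mvPolynomial_derivation_eq {δ δ' : Derivation F (MvPolynomial σ V) (MvPolynomial σ V)}
    (hC : ∀ v, δ (MvPolynomial.C v) = δ' (MvPolynomial.C v))
    (hX : ∀ i, δ (MvPolynomial.X i) = δ' (MvPolynomial.X i)) : δ = δ' := by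
  refine DFunLike.ext _ _ fun w => ?_
  induction w using MvPolynomial.induction_on with
  | C a => exact hC a
  | add p q hp hq => rw [map_add, map_add, hp, hq]
  | mul_X p i hp => rw [δ.leibniz, δ'.leibniz, hp, hX]

theorem derivation_comm_of_comm {δ δ' : Derivation F (MvPolynomial σ V) (MvPolynomial σ V)}
    (hC : ∀ v, δ (δ' (MvPolynomial.C v)) = δ' (δ (MvPolynomial.C v)))
    (hX : ∀ i, δ (δ' (MvPolynomial.X i)) = δ' (δ (MvPolynomial.X i))) (w : MvPolynomial σ V) :
    δ (δ' w) = δ' (δ w) := by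
  have h : ⁅δ, δ'⁆ = 0 := mvPolynomial_derivation_eq
    (fun v => by rw [Derivation.commutator_apply, hC, sub_self, Derivation.zero_apply])
    (fun i => by rw [Derivation.commutator_apply, hX, sub_self, Derivation.zero_apply])
  rw [← sub_eq_zero, ← Derivation.commutator_apply, h, Derivation.zero_apply]

/-- The linear map `∑ a_m X ^ m ↦ ∑ δ(a_m) X ^ m` of polynomials. -/
noncomputable def extendLinear (δ : V →ₗ[F] MvPolynomial σ V) :
    MvPolynomial σ V →ₗ[F] MvPolynomial σ V :=
  (Finsupp.lsum F fun m => LinearMap.mulRight F (MvPolynomial.monomial m (1 : V)) ∘ₗ δ) ∘ₗ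
    (AddMonoidAlgebra.coeffLinearEquiv F).toLinearMap

theorem extendLinear_monomial (δ : V →ₗ[F] MvPolynomial σ V) (m : σ →₀ ℕ) (a : V) :
    extendLinear δ (MvPolynomial.monomial m a) = δ a * MvPolynomial.monomial m 1 :=
  MvPolynomial.sum_monomial_eq (map_zero _)

/-- The derivation of the polynomial algebra that extends a derivation `δ` of the coefficients
and kills the variables. -/
noncomputable def extendDer (δ : Derivation F V (MvPolynomial σ V)) :
    Derivation F (MvPolynomial σ V) (MvPolynomial σ V) :=
  Derivation.mk' (extendLinear δ) fun p q => by
    induction p using MvPolynomial.induction_on' with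
    | add p p' hp hp' => simp only [add_mul, map_add, hp, hp', smul_eq_mul, mul_add]; ring
    | monomial m a =>
      induction q using MvPolynomial.induction_on' with
      | add q q' hq hq' => simp only [mul_add, map_add, hq, hq', smul_eq_mul, add_mul]; ring
      | monomial n b =>
        have monomial_eq (m : σ →₀ ℕ) (a : V) : MvPolynomial.monomial m a =
            MvPolynomial.C a * MvPolynomial.monomial m 1 := by
          rw [MvPolynomial.C_mul_monomial, mul_one]
        have monomial_add : MvPolynomial.monomial (m + n) (1 : V) =
            MvPolynomial.monomial m 1 * MvPolynomial.monomial n 1 := by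
          rw [MvPolynomial.monomial_mul, mul_one]
        rw [MvPolynomial.monomial_mul, extendLinear_monomial, extendLinear_monomial,
          extendLinear_monomial, Derivation.coeFn_coe, δ.leibniz, MvPolynomial.smul_eq_C_mul,
          MvPolynomial.smul_eq_C_mul, smul_eq_mul, smul_eq_mul, monomial_eq m a, monomial_eq n b,
          monomial_add]
        ring

theorem extendDer_C (δ : Derivation F V (MvPolynomial σ V)) (v : V) :
    extendDer δ (MvPolynomial.C v) = δ v :=
  (extendLinear_monomial _ 0 v).trans (mul_one _)

theorem extendDer_X (δ : Derivation F V (MvPolynomial σ V)) (i : σ) :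
    extendDer δ (MvPolynomial.X i) = 0 :=
  (extendLinear_monomial _ _ 1).trans (by rw [Derivation.coeFn_coe, δ.map_one_eq_zero, zero_mul])

variable {ι : Type*} (D : Derivation F V V)

/-- The derivation of the algebra of differential polynomials over `V` in the indeterminates `ι`.
The variable `X (i, n)` stands for the `n`-th derivative of the indeterminate `i`. -/
noncomputable def jetDer : Derivation F (MvPolynomial (ι × ℕ) V) (MvPolynomial (ι × ℕ) V) :=
  extendDer ((Algebra.linearMap V (MvPolynomial (ι × ℕ) V)).compDer D) +
    (MvPolynomial.mkDerivation V fun i : ι × ℕ =>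
      (MvPolynomial.X (i.1, i.2 + 1) : MvPolynomial (ι × ℕ) V)).restrictScalars F

theorem jetDer_C (v : V) :
    jetDer D (MvPolynomial.C v : MvPolynomial (ι × ℕ) V) = MvPolynomial.C (D v) := by
  rw [jetDer, Derivation.add_apply, extendDer_C, Derivation.restrictScalars_apply,
    MvPolynomial.derivation_C, add_zero]
  rfl

theorem jetDer_X (i : ι) (n : ℕ) :
    jetDer D (MvPolynomial.X (i, n)) = MvPolynomial.X (i, n + 1) := by
  rw [jetDer, Derivation.add_apply, extendDer_X, Derivation.restrictScalars_apply,
    MvPolynomial.mkDerivation_X, zero_add]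

theorem jetDer_pow_X (i : ι) (m n : ℕ) :
    ((jetDer (ι := ι) D : Module.End F (MvPolynomial (ι × ℕ) V)) ^ n) (MvPolynomial.X (i, m)) =
      MvPolynomial.X (i, m + n) := by
  induction n with
  | zero => simp
  | succ n ih =>
    rw [pow_succ', Module.End.mul_apply, ih]
    exact jetDer_X D _ _

theorem extendDer_jetDer {δ : Derivation F V (MvPolynomial (ι × ℕ) V)}
    (hδ : ∀ v, δ (D v) = jetDer D (δ v)) (w : MvPolynomial (ι × ℕ) V) :
    extendDer δ (jetDer D w) = jetDer D (extendDer δ w) :=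
  derivation_comm_of_comm (fun v => by rw [jetDer_C, extendDer_C, extendDer_C, hδ])
    (fun i => by rw [jetDer_X, extendDer_X, extendDer_X, map_zero]) w

theorem pderiv_zero_jetDer (i : ι) (w : MvPolynomial (ι × ℕ) V) :
    MvPolynomial.pderiv (i, 0) (jetDer D w) = jetDer D (MvPolynomial.pderiv (i, 0) w) := by
  classical
  refine derivation_comm_of_comm (δ := (MvPolynomial.pderiv (i, 0)).restrictScalars F)
    (fun v => ?_) (fun j => ?_) w
  · simp [jetDer_C]
  · obtain ⟨j, m⟩ := j
    simp only [Derivation.restrictScalars_apply, jetDer_X, MvPolynomial.pderiv_X, Pi.single_apply,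
      Prod.mk.injEq, Nat.add_one_ne_zero, and_false, if_false]
    split_ifs <;> simp

theorem pderiv_succ_jetDer (i : ι) (n : ℕ) (w : MvPolynomial (ι × ℕ) V) :
    MvPolynomial.pderiv (i, n + 1) (jetDer D w) =
      jetDer D (MvPolynomial.pderiv (i, n + 1) w) + MvPolynomial.pderiv (i, n) w := by
  classical
  let P (n : ℕ) : Derivation F (MvPolynomial (ι × ℕ) V) (MvPolynomial (ι × ℕ) V) :=
    (MvPolynomial.pderiv (i, n)).restrictScalars F
  have h : ⁅P (n + 1), jetDer D⁆ = P n := by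
    refine mvPolynomial_derivation_eq (fun v => ?_) fun j => ?_
    · simp [P, Derivation.commutator_apply, jetDer_C]
    · obtain ⟨j, m⟩ := j
      simp only [P, Derivation.commutator_apply, Derivation.restrictScalars_apply, jetDer_X,
        MvPolynomial.pderiv_X, Pi.single_apply, Prod.mk.injEq, Nat.add_right_cancel_iff]
      split_ifs <;> simp
  have := congr($h w)
  rw [Derivation.commutator_apply, sub_eq_iff_eq_add'] at this
  exact this

variable {D}

theorem pderiv_eq_zero_of_pderiv_jetDer_eq_zero (i : ι) (w : MvPolynomial (ι × ℕ) V)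
    (hw : ∀ n, MvPolynomial.pderiv (i, n + 1) (jetDer D w) = 0) (n : ℕ) :
    MvPolynomial.pderiv (i, n) w = 0 := by
  classical
  obtain ⟨K, hK⟩ : ∃ K, ∀ n, K ≤ n → MvPolynomial.pderiv (i, n) w = 0 := by
    refine ⟨(w.vars.image Prod.snd).sup id + 1, fun n hn =>
      MvPolynomial.pderiv_eq_zero_of_notMem_vars fun hmem => ?_⟩
    have : n ≤ (w.vars.image Prod.snd).sup id :=
      Finset.le_sup (f := id) (Finset.mem_image_of_mem Prod.snd hmem)
    omega
  rcases le_total K n with h | h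
  · exact hK n h
  · induction h using Nat.decreasingInduction with
    | self => exact hK K le_rfl
    | of_succ n _ ih =>
      have := hw n
      rwa [pderiv_succ_jetDer, ih, map_zero, zero_add] at this

theorem eq_zero_of_integralMap_X_mul (i : ι) {R : MvPolynomial (ι × ℕ) V}
    (hR : ∀ n, MvPolynomial.pderiv (i, n) R = 0)
    (h : integralMap (jetDer D) (MvPolynomial.X (i, 0) * R) = 0) : R = 0 := by
  classical
  obtain ⟨w, hw⟩ := (Submodule.Quotient.mk_eq_zero _).1 h
  rw [Derivation.coeFn_coe] at hw
  have hP (n : ℕ) : MvPolynomial.pderiv (i, n) (jetDer D w) = if n = 0 then R else 0 := by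
    rw [hw, Derivation.leibniz, hR, smul_zero, zero_add, MvPolynomial.pderiv_X]
    rcases eq_or_ne n 0 with rfl | hn
    · simp
    · rw [Pi.single_eq_of_ne (by simpa using hn.symm), smul_zero, if_neg hn]
  have hw₀ := pderiv_eq_zero_of_pderiv_jetDer_eq_zero i w (fun n => hP (n + 1)) 0
  simpa [hP, hw₀] using pderiv_zero_jetDer D i w

theorem eq_of_integralMap_X_mul_C (i : ι) {v v' : V}
    (h : integralMap (jetDer D) (MvPolynomial.X (i, 0) * MvPolynomial.C v) =
      integralMap (jetDer D) (MvPolynomial.X (i, 0) * MvPolynomial.C v')) : v = v' := by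
  rw [← sub_eq_zero, ← map_sub, ← mul_sub, ← map_sub] at h
  exact sub_eq_zero.1 <| MvPolynomial.C_injective _ _ <|
    (eq_zero_of_integralMap_X_mul i (fun _ => MvPolynomial.pderiv_C) h).trans (map_zero _).symm

theorem symbolApply_X_monomial (i : ι) (n : ℕ) (c : V) :
    symbolApply (jetDer D) (MvPolynomial.X (i, 0)) (monomial n c) =
      MvPolynomial.C c * MvPolynomial.X (i, n) := by
  rw [symbolApply_monomial, jetDer_pow_X, zero_add, MvPolynomial.smul_eq_C_mul]

theorem pderiv_symbolApply_X_self (i : ι) (n : ℕ) (p : V[X]) :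
    MvPolynomial.pderiv (i, n) (symbolApply (jetDer D) (MvPolynomial.X (i, 0)) p) =
      MvPolynomial.C (p.coeff n) := by
  classical
  induction p using Polynomial.induction_on' with
  | add p q hp hq => rw [map_add, map_add, hp, hq, coeff_add, map_add]
  | monomial k a =>
    rw [symbolApply_X_monomial, MvPolynomial.pderiv_C_mul, MvPolynomial.pderiv_X, coeff_monomial]
    rcases eq_or_ne k n with rfl | h
    · simp
    · rw [if_neg h, Pi.single_eq_of_ne (by simpa using h)]; simp

theorem pderiv_symbolApply_X_of_ne {i j : ι} (h : i ≠ j) (n : ℕ) (p : V[X]) :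
    MvPolynomial.pderiv (i, n) (symbolApply (jetDer D) (MvPolynomial.X (j, 0)) p) = 0 := by
  classical
  induction p using Polynomial.induction_on' with
  | add p q hp hq => rw [map_add, map_add, hp, hq, add_zero]
  | monomial k a =>
    rw [symbolApply_X_monomial, MvPolynomial.pderiv_C_mul, MvPolynomial.pderiv_X_of_ne
      (by simp [h.symm]), mul_zero]

theorem symbolApply_X_injective (i : ι) :
    Function.Injective (symbolApply (V := V) (jetDer D) (MvPolynomial.X (i, 0))) := by
  intro p q h
  ext n
  apply MvPolynomial.C_injective (ι × ℕ)
  rw [← pderiv_symbolApply_X_self (D := D) i, h, pderiv_symbolApply_X_self]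

/-- The bidifferential expression `∑ p_{mn} X_i^{(m)} X_j^{(n)}` attached to the polynomial
`p = ∑ p_{mn} λ ^ m μ ^ n`. -/
noncomputable def jetApply₂ (D : Derivation F V V) (i j : ι) :
    V[X][X] →ₗ[F] MvPolynomial (ι × ℕ) V :=
  Polynomial.lsum fun n => LinearMap.mulRight F (MvPolynomial.X (j, n)) ∘ₗ
    (symbolApply (jetDer D) (MvPolynomial.X (i, 0))).restrictScalars F

theorem jetApply₂_monomial (i j : ι) (n : ℕ) (q : V[X]) :
    jetApply₂ D i j (monomial n q) =
      symbolApply (jetDer D) (MvPolynomial.X (i, 0)) q * MvPolynomial.X (j, n) := by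
  simp [jetApply₂, Polynomial.lsum_apply]

theorem pderiv_jetApply₂_self {i j : ι} (h : j ≠ i) (n : ℕ) (p : V[X][X]) :
    MvPolynomial.pderiv (j, n) (jetApply₂ D i j p) =
      symbolApply (jetDer D) (MvPolynomial.X (i, 0)) (p.coeff n) := by
  classical
  induction p using Polynomial.induction_on' with
  | add p q hp hq => rw [map_add, map_add, hp, hq, coeff_add, map_add]
  | monomial k q =>
    rw [jetApply₂_monomial, Derivation.leibniz, pderiv_symbolApply_X_of_ne h,
      MvPolynomial.pderiv_X, coeff_monomial]
    rcases eq_or_ne k n with rfl | hk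
    · simp
    · rw [if_neg hk, Pi.single_eq_of_ne (by simpa using hk)]; simp

theorem pderiv_jetApply₂_of_ne {i j k : ι} (hi : k ≠ i) (hj : k ≠ j) (n : ℕ) (p : V[X][X]) :
    MvPolynomial.pderiv (k, n) (jetApply₂ D i j p) = 0 := by
  induction p using Polynomial.induction_on' with
  | add p q hp hq => rw [map_add, map_add, hp, hq, add_zero]
  | monomial m q =>
    rw [jetApply₂_monomial, Derivation.leibniz, pderiv_symbolApply_X_of_ne hi,
      MvPolynomial.pderiv_X_of_ne (by simp [hj.symm]), smul_zero, smul_zero, add_zero]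

theorem jetApply₂_injective {i j : ι} (h : j ≠ i) :
    Function.Injective (jetApply₂ (F := F) D i j) := by
  intro p q hpq
  ext1 n
  apply symbolApply_X_injective (D := D) i
  rw [← pderiv_jetApply₂_self h, hpq, pderiv_jetApply₂_self h]

theorem jetApply₂_shift (i j : ι) (s : V) (k m n : ℕ) :
    jetApply₂ D i j (C (C s * X ^ m) * X ^ n * (C X + X) ^ k) =
      s • ((jetDer (ι := ι) D : Module.End F (MvPolynomial (ι × ℕ) V)) ^ k)
        (MvPolynomial.X (i, m) * MvPolynomial.X (j, n)) := by
  induction k generalizing m n with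
  | zero =>
    rw [pow_zero, mul_one, C_mul_X_pow_eq_monomial, jetApply₂_monomial, C_mul_X_pow_eq_monomial,
      symbolApply_X_monomial, pow_zero, Module.End.one_apply, MvPolynomial.smul_eq_C_mul, mul_assoc]
  | succ k ih =>
    have h : (C (C s * X ^ m) * X ^ n * (C X + X) ^ (k + 1) : V[X][X]) =
        C (C s * X ^ (m + 1)) * X ^ n * (C X + X) ^ k +
          C (C s * X ^ m) * X ^ (n + 1) * (C X + X) ^ k := by
      simp only [map_mul, map_pow]; ring
    have hD : jetDer D (MvPolynomial.X (i, m) * MvPolynomial.X (j, n)) =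
        MvPolynomial.X (i, m + 1) * MvPolynomial.X (j, n) +
          MvPolynomial.X (i, m) * MvPolynomial.X (j, n + 1) := by
      rw [Derivation.leibniz, jetDer_X, jetDer_X, smul_eq_mul, smul_eq_mul]; ring
    rw [h, map_add, ih, ih, ← smul_add, ← map_add, pow_succ, Module.End.mul_apply,
      Derivation.coeFn_coe, hD]

end Jets

/-! ### Hamiltonian vector fields on differential polynomials -/

namespace LambdaBracket

variable {F : Type*} [Field F] {V : Type*} [CommRing V] [Algebra F V] {D : Derivation F V V}

section

variable {W : Type*} [CommRing W] [Algebra F W] [Algebra V W] [IsScalarTower F V W]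
  (L : LambdaBracket D) (E : Derivation F W W)

/-- The Hamiltonian derivation `v ↦ {a_∂ v} f` over `V`, which is `v ↦ {∫ a f, v}` when `f` is
constant for the bracket. -/
noncomputable def hamDer (a : V) (f : W) : Derivation F V W :=
  Derivation.mk' ((symbolApply E f).restrictScalars F ∘ₗ L.br a) fun u v => by
    simp only [LinearMap.comp_apply, LinearMap.restrictScalars_apply, L.leibniz_right, map_add,
      symbolApply_C_mul]
    exact add_comm _ _

theorem hamDer_apply (a : V) (f : W) (v : V) : L.hamDer E a f v = symbolApply E f (L.br a v) := rfl

variable {E} (hE : ∀ v, E (algebraMap V W v) = algebraMap V W (D v))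

include hE

theorem hamDer_comm (a : V) (f : W) (v : V) : L.hamDer E a f (D v) = E (L.hamDer E a f v) := by
  rw [hamDer_apply, L.sesq_right, symbolApply_lambdaAdd hE, hamDer_apply]

/-- The derivation `a ↦ {a_∂ u}^* f`, adjoint to the Hamiltonian derivations. -/
noncomputable def cohamDer (u : V) (f : W) : Derivation F V W :=
  Derivation.mk' (symbolCoapply E f ∘ₗ L.br.flip u) fun a b => by
    simp only [LinearMap.comp_apply, LinearMap.flip_apply, L.leibniz_left, map_add,
      symbolCoapply_shiftApply hE]
    exact add_comm _ _

theorem cohamDer_apply (u : V) (f : W) (a : V) :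
    L.cohamDer hE u f a = symbolCoapply E f (L.br a u) := rfl

theorem cohamDer_comm (u : V) (f : W) (a : V) :
    L.cohamDer hE u f (D a) = E (L.cohamDer hE u f a) := by
  rw [cohamDer_apply, L.sesq_left, map_neg, symbolCoapply_X_mul, neg_neg, cohamDer_apply]

theorem integralMap_mul_hamDer_skew {a b : V} (h : L.br b a = -negShift D (L.br a b)) (f g : W) :
    integralMap E (f * L.hamDer E b g a) = -integralMap E (g * L.hamDer E a f b) := by
  rw [hamDer_apply, h, map_neg, symbolApply_negShift hE, mul_neg, map_neg,
    ← integralMap_mul_symbolApply, hamDer_apply]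

end

theorem negShift_negShift (p : V[X]) : negShift D (negShift D p) = p := by
  refine symbolApply_X_injective (D := D) (0 : Fin 2) (sub_eq_zero.1 ?_)
  refine eq_zero_of_integralMap_X_mul (D := D) 1 (fun n => ?_) ?_
  · rw [map_sub, pderiv_symbolApply_X_of_ne (by decide), pderiv_symbolApply_X_of_ne (by decide),
      sub_zero]
  · rw [mul_sub, map_sub, symbolApply_negShift (jetDer_C D), ← integralMap_mul_symbolApply,
      symbolApply_negShift (jetDer_C D), ← integralMap_mul_symbolApply, sub_self]

theorem eq_neg_negShift_comm {p q : V[X]} : p = -negShift D q ↔ q = -negShift D p := by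
  have of_eq {p q : V[X]} (h : p = -negShift D q) : q = -negShift D p := by
    rw [eq_neg_iff_add_eq_zero] at h ⊢
    rw [← negShift_negShift (D := D) q, ← negShift_add, add_comm, h]
    exact sum_zero_index _
  exact ⟨of_eq, of_eq⟩

variable {ι : Type*} (L : LambdaBracket D)

theorem skew_iff_symbolApply (i : ι) (a b : V) : L.br b a = -negShift D (L.br a b) ↔
    symbolApply (jetDer D) (MvPolynomial.X (i, 0)) (L.br b a) =
      -symbolCoapply (jetDer D) (MvPolynomial.X (i, 0)) (L.br a b) := by
  rw [← (symbolApply_X_injective (D := D) i).eq_iff, map_neg, symbolApply_negShift (jetDer_C D)]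

/-- The extension of the Hamiltonian derivation `v ↦ {a_∂ v} f` to a vector field on differential
polynomials that annihilates the indeterminates. -/
noncomputable def hamField (a : V) (f : MvPolynomial (ι × ℕ) V) :
    Derivation F (MvPolynomial (ι × ℕ) V) (MvPolynomial (ι × ℕ) V) :=
  extendDer (L.hamDer (jetDer D) a f)

theorem hamField_C (a : V) (f : MvPolynomial (ι × ℕ) V) (v : V) :
    L.hamField a f (MvPolynomial.C v) = L.hamDer (jetDer D) a f v := extendDer_C _ _

theorem hamField_X (a : V) (f : MvPolynomial (ι × ℕ) V) (x : ι × ℕ) :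
    L.hamField a f (MvPolynomial.X x) = 0 := extendDer_X _ _

theorem hamField_X_mul (a : V) (f : MvPolynomial (ι × ℕ) V) (x : ι × ℕ)
    (w : MvPolynomial (ι × ℕ) V) :
    L.hamField a f (MvPolynomial.X x * w) = MvPolynomial.X x * L.hamField a f w := by
  rw [Derivation.leibniz, hamField_X, smul_zero, add_zero, smul_eq_mul]

theorem hamField_jetDer (a : V) (f w : MvPolynomial (ι × ℕ) V) :
    L.hamField a f (jetDer D w) = jetDer D (L.hamField a f w) :=
  extendDer_jetDer D (L.hamDer_comm (jetDer_C D) a f) w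

theorem hamField_symbolApply_X (a : V) (f : MvPolynomial (ι × ℕ) V) (i : ι) (p : V[X]) :
    L.hamField a f (symbolApply (jetDer D) (MvPolynomial.X (i, 0)) p) =
      p.sum fun n r => MvPolynomial.X (i, n) * L.hamDer (jetDer D) a f r := by
  induction p using Polynomial.induction_on' with
  | add p q hp hq =>
    rw [map_add, map_add, hp, hq, sum_add_index p q _ (by simp) (by simp [mul_add])]
  | monomial n r =>
    rw [symbolApply_X_monomial, mul_comm, hamField_X_mul, hamField_C,
      sum_monomial_index _ _ (by simp)]

/-- The derivation `c ↦ {{a_λ b}_{λ+μ} c}` tested on the `i`-th and `j`-th indeterminates, with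
`p = {a_λ b}`. -/
noncomputable def nestedDer (i j : ι) (p : V[X]) : Derivation F V (MvPolynomial (ι × ℕ) V) :=
  p.sum fun n r => L.hamDer (jetDer D) r (MvPolynomial.X (i, n) * MvPolynomial.X (j, 0))

theorem nestedDer_apply (i j : ι) (p : V[X]) (v : V) :
    L.nestedDer i j p v = p.sum fun n r =>
      L.hamDer (jetDer D) r (MvPolynomial.X (i, n) * MvPolynomial.X (j, 0)) v := by
  simp only [nestedDer, Polynomial.sum, ← Derivation.coeFnAddMonoidHom_apply, map_sum,
    Finset.sum_apply]

/-- The difference of the two sides of the Jacobi identity, in `V[λ][μ]`. -/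
noncomputable def jacobiator (a b c : V) : V[X][X] :=
  ((L.br b c).sum fun n r => C (L.br a r) * (X : V[X][X]) ^ n) -
    ((L.br a c).sum fun n r => (L.br b r).map C * C (X ^ n)) -
    (L.br a b).sum fun n r => C (X ^ n) * (L.br r c).eval₂ (C.comp C) (C X + X)

theorem jetApply₂_nested_left (i j : ι) (a : V) (p : V[X]) :
    jetApply₂ D i j (p.sum fun n r => C (L.br a r) * (X : V[X][X]) ^ n) =
      L.hamField a (MvPolynomial.X (i, 0))
        (symbolApply (jetDer D) (MvPolynomial.X (j, 0)) p) := by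
  rw [hamField_symbolApply_X, Polynomial.sum, map_sum]
  refine Finset.sum_congr rfl fun n _ => ?_
  rw [C_mul_X_pow_eq_monomial, jetApply₂_monomial, mul_comm]
  rfl

theorem jetApply₂_nested_right (i j : ι) (b : V) (p : V[X]) :
    jetApply₂ D i j (p.sum fun n r => (L.br b r).map C * C (X ^ n)) =
      L.hamField b (MvPolynomial.X (j, 0))
        (symbolApply (jetDer D) (MvPolynomial.X (i, 0)) p) := by
  rw [hamField_symbolApply_X, Polynomial.sum, map_sum]
  refine Finset.sum_congr rfl fun n _ => ?_
  simp only [hamDer_apply]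
  induction L.br b (p.coeff n) using Polynomial.induction_on' with
  | add p q hp hq => rw [Polynomial.map_add, add_mul, map_add, hp, hq, map_add, mul_add]
  | monomial k s =>
    rw [map_monomial, mul_comm, C_mul_monomial, jetApply₂_monomial, X_pow_mul_C,
      C_mul_X_pow_eq_monomial, symbolApply_X_monomial, symbolApply_X_monomial]
    ring

theorem jetApply₂_nested_add (i j : ι) (c : V) (p : V[X]) :
    jetApply₂ D i j (p.sum fun n r => C (X ^ n) * (L.br r c).eval₂ (C.comp C) (C X + X)) =
      L.nestedDer i j p c := by
  rw [nestedDer_apply, Polynomial.sum, map_sum]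
  refine Finset.sum_congr rfl fun n _ => ?_
  simp only [hamDer_apply]
  induction L.br (p.coeff n) c using Polynomial.induction_on' with
  | add p q hp hq => rw [eval₂_add, mul_add, map_add, hp, hq, map_add]
  | monomial k s =>
    rw [eval₂_monomial, symbolApply_monomial, ← jetApply₂_shift]
    congr 1
    simp only [RingHom.comp_apply, map_mul]
    ring

theorem jetApply₂_jacobiator (i j : ι) (a b c : V) :
    jetApply₂ D i j (L.jacobiator a b c) =
      L.hamField a (MvPolynomial.X (i, 0)) (L.hamDer (jetDer D) b (MvPolynomial.X (j, 0)) c) -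
        L.hamField b (MvPolynomial.X (j, 0)) (L.hamDer (jetDer D) a (MvPolynomial.X (i, 0)) c) -
        L.nestedDer i j (L.br a b) c := by
  rw [jacobiator, map_sub, map_sub, jetApply₂_nested_left, jetApply₂_nested_right,
    jetApply₂_nested_add, hamDer_apply, hamDer_apply]

/-- The cyclic sum `∑ ∫ X_k {a, {b, c}}` of nested brackets, tested on three indeterminates. -/
noncomputable def jacobiCycle (i j k : ι) (a b c : V) :
    LocalFunctional (jetDer (ι := ι) D) :=
  integralMap (jetDer D) (MvPolynomial.X (k, 0) * L.hamField a (MvPolynomial.X (i, 0))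
      (L.hamDer (jetDer D) b (MvPolynomial.X (j, 0)) c)) +
    integralMap (jetDer D) (MvPolynomial.X (i, 0) * L.hamField b (MvPolynomial.X (j, 0))
      (L.hamDer (jetDer D) c (MvPolynomial.X (k, 0)) a)) +
    integralMap (jetDer D) (MvPolynomial.X (j, 0) * L.hamField c (MvPolynomial.X (k, 0))
      (L.hamDer (jetDer D) a (MvPolynomial.X (i, 0)) b))

theorem jacobiCycle_rotate (i j k : ι) (a b c : V) :
    L.jacobiCycle i j k a b c = L.jacobiCycle j k i b c a := by
  unfold jacobiCycle; abel

variable {L}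

theorem integralMap_hamField_hamDer_skew (i j k : ι) (b : V) {a c : V}
    (h : L.br c a = -negShift D (L.br a c)) :
    integralMap (jetDer D) (MvPolynomial.X (i, 0) * L.hamField b (MvPolynomial.X (j, 0))
        (L.hamDer (jetDer D) c (MvPolynomial.X (k, 0)) a)) =
      -integralMap (jetDer D) (MvPolynomial.X (k, 0) * L.hamField b (MvPolynomial.X (j, 0))
        (L.hamDer (jetDer D) a (MvPolynomial.X (i, 0)) c)) := by
  have hskew := L.integralMap_mul_hamDer_skew (jetDer_C D) h (MvPolynomial.X (i, 0))
    (MvPolynomial.X (k, 0))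
  rw [eq_neg_iff_add_eq_zero, ← map_add] at hskew ⊢
  obtain ⟨w, hw⟩ := (Submodule.Quotient.mk_eq_zero _).1 hskew
  refine (Submodule.Quotient.mk_eq_zero _).2 ⟨L.hamField b (MvPolynomial.X (j, 0)) w, ?_⟩
  rw [Derivation.coeFn_coe, ← hamField_jetDer, ← hamField_X_mul, ← hamField_X_mul, ← map_add,
    ← hw, Derivation.coeFn_coe]

theorem integralMap_X_mul_nestedDer (i j k : ι) {a b c : V}
    (h : ∀ n, L.br c ((L.br a b).coeff n) = -negShift D (L.br ((L.br a b).coeff n) c)) :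
    integralMap (jetDer D) (MvPolynomial.X (k, 0) * L.nestedDer i j (L.br a b) c) =
      -integralMap (jetDer D) (MvPolynomial.X (j, 0) * L.hamField c (MvPolynomial.X (k, 0))
        (L.hamDer (jetDer D) a (MvPolynomial.X (i, 0)) b)) := by
  rw [nestedDer_apply, hamDer_apply L _ a, hamField_symbolApply_X, Polynomial.sum, Polynomial.sum,
    Finset.mul_sum, Finset.mul_sum, map_sum, map_sum, ← Finset.sum_neg_distrib]
  refine Finset.sum_congr rfl fun n _ => ?_
  rw [← mul_assoc, mul_comm (MvPolynomial.X (j, 0))]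
  exact (neg_eq_iff_eq_neg.2 (L.integralMap_mul_hamDer_skew (jetDer_C D) (h n) _ _)).symm

theorem integralMap_X_mul_jetApply₂_jacobiator (i j k : ι) {a b c : V}
    (hac : L.br c a = -negShift D (L.br a c))
    (hab : ∀ n, L.br c ((L.br a b).coeff n) = -negShift D (L.br ((L.br a b).coeff n) c)) :
    integralMap (jetDer D) (MvPolynomial.X (k, 0) * jetApply₂ D i j (L.jacobiator a b c)) =
      L.jacobiCycle i j k a b c := by
  rw [jetApply₂_jacobiator, mul_sub, mul_sub, map_sub, map_sub,
    integralMap_X_mul_nestedDer i j k hab, jacobiCycle,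
    integralMap_hamField_hamDer_skew i j k b hac, ← sub_eq_add_neg, sub_neg_eq_add]

end LambdaBracket

/-! ### The differential subalgebra generated by the coefficients -/

section CoeffSubalgebra

variable {F : Type*} [Field F] {V : Type*} [CommRing V] [Algebra F V] {D : Derivation F V V} {N : ℕ}
  {A : Matrix (Fin N) (Fin N) (PseudoDiffOp D)}

theorem coeff_mem_coeffSubalgebra (A : Matrix (Fin N) (Fin N) (PseudoDiffOp D)) (i j : Fin N)
    (m : ℤ) : (A i j).coeff m ∈ coeffSubalgebra A :=
  Algebra.subset_adjoin ⟨i, j, m, 0, rfl⟩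

theorem derivation_mem_coeffSubalgebra {v : V} (hv : v ∈ coeffSubalgebra A) :
    D v ∈ coeffSubalgebra A := by
  induction hv using Algebra.adjoin_induction with
  | mem x hx =>
    obtain ⟨i, j, m, r, rfl⟩ := hx
    exact Algebra.subset_adjoin ⟨i, j, m, r + 1, (Function.iterate_succ_apply' _ _ _).symm⟩
  | algebraMap r => rw [D.map_algebraMap]; exact Subalgebra.zero_mem _
  | add x y _ _ hx hy => rw [map_add]; exact Subalgebra.add_mem _ hx hy
  | mul x y hx' hy' hx hy =>
    rw [D.leibniz]
    exact Subalgebra.add_mem _ (Subalgebra.mul_mem _ hx' hy) (Subalgebra.mul_mem _ hy' hx)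

@[elab_as_elim]
theorem coeffSubalgebra_induction {p : ∀ v, v ∈ coeffSubalgebra A → Prop}
    (algebraMap : ∀ r : F, p (algebraMap F V r) (Subalgebra.algebraMap_mem _ r))
    (coeff : ∀ i j m, p ((A i j).coeff m) (coeff_mem_coeffSubalgebra A i j m))
    (der : ∀ v hv, p v hv → p (D v) (derivation_mem_coeffSubalgebra hv))
    (add : ∀ u v hu hv, p u hu → p v hv → p (u + v) (Subalgebra.add_mem _ hu hv))
    (mul : ∀ u v hu hv, p u hu → p v hv → p (u * v) (Subalgebra.mul_mem _ hu hv))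
    {v : V} (hv : v ∈ coeffSubalgebra A) : p v hv := by
  induction hv using Algebra.adjoin_induction with
  | mem x hx =>
    obtain ⟨i, j, m, r, rfl⟩ := hx
    induction r with
    | zero => exact coeff i j m
    | succ r ih =>
      simp only [Function.iterate_succ_apply']
      exact der _ _ ih
  | algebraMap r => exact algebraMap r
  | add x y _ _ hx hy => exact add x y _ _ hx hy
  | mul x y _ _ hx hy => exact mul x y _ _ hx hy

theorem coeffSubalgebra_add_const_le (A : Matrix (Fin N) (Fin N) (PseudoDiffOp D)) (ε : F) :
    coeffSubalgebra (A + Matrix.diagonal fun _ => PseudoDiffOp.const D (algebraMap F V ε)) ≤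
      coeffSubalgebra A := by
  intro v hv
  induction hv using coeffSubalgebra_induction with
  | algebraMap r => exact Subalgebra.algebraMap_mem _ r
  | coeff i j m =>
    rw [Matrix.add_apply, PseudoDiffOp.coeff_add, Matrix.diagonal_apply]
    refine Subalgebra.add_mem _ (coeff_mem_coeffSubalgebra A i j m) ?_
    split_ifs
    · rw [PseudoDiffOp.coeff_const]
      split_ifs
      exacts [Subalgebra.algebraMap_mem _ _, Subalgebra.zero_mem _]
    · exact Subalgebra.zero_mem _
  | der v _ hv => exact derivation_mem_coeffSubalgebra hv
  | add u v _ _ hu hv => exact Subalgebra.add_mem _ hu hv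
  | mul u v _ _ hu hv => exact Subalgebra.mul_mem _ hu hv

theorem coeffSubalgebra_add_const (A : Matrix (Fin N) (Fin N) (PseudoDiffOp D)) (ε : F) :
    coeffSubalgebra (A + Matrix.diagonal fun _ => PseudoDiffOp.const D (algebraMap F V ε)) =
      coeffSubalgebra A := by
  refine le_antisymm (coeffSubalgebra_add_const_le A ε) ?_
  have hconst : PseudoDiffOp.const D (algebraMap F V ε) +
      PseudoDiffOp.const D (algebraMap F V (-ε)) = 0 := by
    ext n
    simp only [PseudoDiffOp.coeff_add, PseudoDiffOp.coeff_const, map_neg]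
    split_ifs
    exacts [add_neg_cancel _, add_zero _]
  have h := coeffSubalgebra_add_const_le
    (A + Matrix.diagonal fun _ => PseudoDiffOp.const D (algebraMap F V ε)) (-ε)
  rwa [add_assoc, Matrix.diagonal_add, hconst, Matrix.diagonal_zero, add_zero] at h

theorem derivation_eqOn_coeffSubalgebra {W : Type*} [CommRing W] [Algebra F W] [Module V W]
    {E : Derivation F W W} {δ δ' : Derivation F V W} (hδ : ∀ v, δ (D v) = E (δ v))
    (hδ' : ∀ v, δ' (D v) = E (δ' v)) (h : ∀ i j m, δ ((A i j).coeff m) = δ' ((A i j).coeff m)) :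
    Set.EqOn δ δ' (coeffSubalgebra A) := by
  intro v hv
  induction hv using coeffSubalgebra_induction with
  | algebraMap r => rw [δ.map_algebraMap, δ'.map_algebraMap]
  | coeff i j m => exact h i j m
  | der v _ hv => rw [hδ, hδ', hv]
  | add u v _ _ hu hv => rw [map_add, map_add, hu, hv]
  | mul u v _ _ hu hv => rw [δ.leibniz, δ'.leibniz, hu, hv]

end CoeffSubalgebra

section CoeffsIn

variable {F : Type*} [Field F] {V : Type*} [CommRing V] [Algebra F V] {D : Derivation F V V}
  {S : Subalgebra F V}

/-- The polynomials with all coefficients in a subalgebra, as a subspace of `V[λ]`. -/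
def coeffsIn (S : Subalgebra F V) : Submodule F V[X] where
  carrier := {p | ∀ n, p.coeff n ∈ S}
  zero_mem' _ := by simp
  add_mem' hp hq n := by rw [coeff_add]; exact S.add_mem (hp n) (hq n)
  smul_mem' r p hp n := by rw [coeff_smul]; exact S.smul_mem (hp n) r

theorem C_mul_mem_coeffsIn {a : V} (ha : a ∈ S) {p : V[X]} (hp : p ∈ coeffsIn S) :
    C a * p ∈ coeffsIn S := fun n => by
  rw [coeff_C_mul]; exact S.mul_mem ha (hp n)

theorem C_mem_coeffsIn {a : V} (ha : a ∈ S) : C a ∈ coeffsIn S := fun n => by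
  rw [coeff_C]; split_ifs; exacts [ha, S.zero_mem]

theorem X_mul_mem_coeffsIn {p : V[X]} (hp : p ∈ coeffsIn S) : X * p ∈ coeffsIn S := by
  rintro (_ | n)
  · rw [coeff_X_mul_zero]; exact S.zero_mem
  · rw [coeff_X_mul]; exact hp n

theorem pow_apply_mem {M : Type*} [AddCommGroup M] [Module F M] {P : Submodule F M}
    {T : Module.End F M} (hT : ∀ x ∈ P, T x ∈ P) (n : ℕ) {x : M} (hx : x ∈ P) :
    (T ^ n) x ∈ P := by
  induction n with
  | zero => exact hx
  | succ n ih => rw [pow_succ', Module.End.mul_apply]; exact hT _ ih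

theorem powCoeff_apply_mem {M : Type*} [AddCommGroup M] [Module F M] {P : Submodule F M}
    {T : Module.End F M} (hT : ∀ x ∈ P, T x ∈ P) (q s : ℤ) {x : M} (hx : x ∈ P) :
    powCoeff T q s x ∈ P := by
  unfold powCoeff
  split_ifs
  · exact zsmul_mem (pow_apply_mem hT _ hx) _
  · exact P.zero_mem

variable (hS : ∀ v ∈ S, D v ∈ S)

include hS

theorem lambdaAdd_mem_coeffsIn (p : V[X]) (hp : p ∈ coeffsIn S) :
    lambdaAdd D p ∈ coeffsIn S := fun n => by
  rw [coeff_lambdaAdd]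
  exact S.add_mem (X_mul_mem_coeffsIn hp n) (hS _ (hp n))

theorem shiftApply_mem_coeffsIn {p : V[X]} (hp : p ∈ coeffsIn S) {b : V} (hb : b ∈ S) :
    shiftApply D p b ∈ coeffsIn S :=
  Submodule.sum_mem _ fun n _ => C_mul_mem_coeffsIn (hp n)
    (pow_apply_mem (lambdaAdd_mem_coeffsIn hS) n (C_mem_coeffsIn hb))

theorem adlerCoeff_mem_coeffsIn {P Q : PseudoDiffOp D} (hP : ∀ n, P.coeff n ∈ S)
    (hQ : ∀ n, Q.coeff n ∈ S) (m n : ℤ) : adlerCoeff P Q m n ∈ coeffsIn S := by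
  have hneg (p) (hp : p ∈ coeffsIn S) : (-lambdaAdd D) p ∈ coeffsIn S :=
    neg_mem (lambdaAdd_mem_coeffsIn hS p hp)
  refine sub_mem ?_ ?_ <;> refine finsum_induction (· ∈ coeffsIn S) (Submodule.zero_mem _)
    (fun _ _ => Submodule.add_mem _) fun t => C_mul_mem_coeffsIn (hP _)
      (powCoeff_apply_mem (lambdaAdd_mem_coeffsIn hS) _ _ ?_)
  · exact powCoeff_apply_mem hneg _ _ (C_mem_coeffsIn (hQ _))
  · exact C_mem_coeffsIn (hQ _)

end CoeffsIn

/-! ### Operators of Adler type generate Poisson vertex algebras -/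

open LambdaBracket PseudoDiffOp

section Closed

variable {F : Type*} [Field F] {V : Type*} [CommRing V] [Algebra F V] {D : Derivation F V V} {N : ℕ}
  {A : Matrix (Fin N) (Fin N) (PseudoDiffOp D)}

theorem LambdaBracket.br_algebraMap_right (L : LambdaBracket D) (a : V) (r : F) :
    L.br a (algebraMap F V r) = 0 := by
  refine symbolApply_X_injective (D := D) () ?_
  rw [← hamDer_apply, Derivation.map_algebraMap, map_zero]

theorem LambdaBracket.br_algebraMap_left (L : LambdaBracket D) (r : F) (b : V) :
    L.br (algebraMap F V r) b = 0 := by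
  rw [← negShift_negShift (D := D) (L.br _ b)]
  suffices h : negShift D (L.br (algebraMap F V r) b) = 0 by
    rw [h]; exact sum_zero_index _
  refine symbolApply_X_injective (D := D) () ?_
  rw [symbolApply_negShift (jetDer_C D), ← cohamDer_apply L (jetDer_C D),
    Derivation.map_algebraMap, map_zero]

theorem LambdaBracket.br_mem_coeffsIn_right (L : LambdaBracket D) {a b : V}
    (h : ∀ i j m, L.br a ((A i j).coeff m) ∈ coeffsIn (coeffSubalgebra A))
    (hb : b ∈ coeffSubalgebra A) : L.br a b ∈ coeffsIn (coeffSubalgebra A) := by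
  induction hb using coeffSubalgebra_induction with
  | algebraMap r => rw [br_algebraMap_right]; exact Submodule.zero_mem _
  | coeff i j m => exact h i j m
  | der v _ hv =>
    rw [L.sesq_right]
    exact lambdaAdd_mem_coeffsIn (fun _ => derivation_mem_coeffSubalgebra) _ hv
  | add u v _ _ hu hv => rw [map_add]; exact Submodule.add_mem _ hu hv
  | mul u v hu' hv' hu hv =>
    rw [L.leibniz_right]
    exact Submodule.add_mem _ (C_mul_mem_coeffsIn hv' hu) (C_mul_mem_coeffsIn hu' hv)

theorem LambdaBracket.br_mem_coeffsIn_left (L : LambdaBracket D) {a b : V}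
    (h : ∀ i j m, L.br ((A i j).coeff m) b ∈ coeffsIn (coeffSubalgebra A))
    (ha : a ∈ coeffSubalgebra A) : L.br a b ∈ coeffsIn (coeffSubalgebra A) := by
  induction ha using coeffSubalgebra_induction with
  | algebraMap r => rw [br_algebraMap_left]; exact Submodule.zero_mem _
  | coeff i j m => exact h i j m
  | der v _ hv => rw [L.sesq_left]; exact neg_mem (X_mul_mem_coeffsIn hv)
  | add u v _ _ hu hv => rw [map_add]; exact Submodule.add_mem _ hu hv
  | mul u v hu' hv' hu hv =>
    have hS : ∀ v ∈ coeffSubalgebra A, D v ∈ coeffSubalgebra A :=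
      fun _ => derivation_mem_coeffSubalgebra
    rw [L.leibniz_left]
    exact Submodule.add_mem _ (shiftApply_mem_coeffsIn hS hu hv')
      (shiftApply_mem_coeffsIn hS hv hu')

end Closed

namespace IsAdlerType

variable {F : Type*} [Field F] {V : Type*} [CommRing V] [Algebra F V] {D : Derivation F V V} {N : ℕ}
  {L : LambdaBracket D} {A : Matrix (Fin N) (Fin N) (PseudoDiffOp D)} (hA : IsAdlerType L A)

include hA

theorem br_mem_coeffsIn {a b : V} (ha : a ∈ coeffSubalgebra A) (hb : b ∈ coeffSubalgebra A) :
    L.br a b ∈ coeffsIn (coeffSubalgebra A) := by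
  refine L.br_mem_coeffsIn_left (fun i j m => L.br_mem_coeffsIn_right (fun h k n => ?_) hb) ha
  rw [hA]
  exact adlerCoeff_mem_coeffsIn (fun _ => derivation_mem_coeffSubalgebra)
    (coeff_mem_coeffSubalgebra A _ _) (coeff_mem_coeffSubalgebra A _ _) _ _

theorem matrixDer_hamDer {W : Type*} [CommRing W] [Algebra F W] [Algebra V W]
    [IsScalarTower F V W] {E : Derivation F W W}
    (hE : ∀ v, E (algebraMap V W v) = algebraMap V W (D v)) (i j : Fin N) (m : ℤ) (f : W) :
    matrixDer E (L.hamDer E ((A i j).coeff m) f) A =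
      (matrixRotaBaxter (Fin N) E).adler (matrixMap (Fin N) hE A) (matrixMap (Fin N) hE A)
        (testOp E j i m f) := by
  ext h k n
  rw [testOp, TracedRotaBaxter.adler_single_apply, coeff_matrixDer, hamDer_apply, hA,
    symbolApply_adlerCoeff hE]
  rfl

theorem skew_coeff (i j h k : Fin N) (m n : ℤ) :
    L.br ((A h k).coeff n) ((A i j).coeff m) =
      -negShift D (L.br ((A i j).coeff m) ((A h k).coeff n)) := by
  rw [L.skew_iff_symbolApply (0 : Fin 2), eq_neg_iff_add_eq_zero,
    ← symbolApply_negShift (jetDer_C D), ← map_add]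
  refine eq_zero_of_integralMap_X_mul (D := D) 1 (pderiv_symbolApply_X_of_ne (by decide) · _) ?_
  rw [map_add, symbolApply_negShift (jetDer_C D), mul_add, map_add, ← integralMap_mul_symbolApply,
    ← hamDer_apply, ← hamDer_apply, ← coeff_matrixDer, ← coeff_matrixDer, ← tr_mul_testOp,
    ← tr_mul_testOp, hA.matrixDer_hamDer (jetDer_C D), hA.matrixDer_hamDer (jetDer_C D),
    TracedRotaBaxter.tr_adler_skew, neg_add_cancel]

end IsAdlerType

theorem LambdaBracket.skew_of_skew_coeff {F : Type*} [Field F] {V : Type*} [CommRing V]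
    [Algebra F V] {D : Derivation F V V} {N : ℕ} (L : LambdaBracket D)
    {A : Matrix (Fin N) (Fin N) (PseudoDiffOp D)} {a : V}
    (h : ∀ i j m, L.br ((A i j).coeff m) a = -negShift D (L.br a ((A i j).coeff m)))
    {b : V} (hb : b ∈ coeffSubalgebra A) : L.br b a = -negShift D (L.br a b) := by
  rw [eq_neg_negShift_comm, L.skew_iff_symbolApply ()]
  refine derivation_eqOn_coeffSubalgebra (δ := L.hamDer (jetDer D) a _)
    (δ' := -L.cohamDer (jetDer_C D) a _) (L.hamDer_comm (jetDer_C D) a _) (fun v => ?_)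
    (fun i j m => ?_) hb
  · rw [Derivation.neg_apply, Derivation.neg_apply, L.cohamDer_comm (jetDer_C D), map_neg]
  · exact (L.skew_iff_symbolApply _ _ _).1 (eq_neg_negShift_comm.1 (h i j m))

namespace IsAdlerType

variable {F : Type*} [Field F] {V : Type*} [CommRing V] [Algebra F V] {D : Derivation F V V} {N : ℕ}
  {L : LambdaBracket D} {A : Matrix (Fin N) (Fin N) (PseudoDiffOp D)} (hA : IsAdlerType L A)

include hA

theorem skew {a b : V} (ha : a ∈ coeffSubalgebra A) (hb : b ∈ coeffSubalgebra A) :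
    L.br b a = -negShift D (L.br a b) :=
  L.skew_of_skew_coeff (fun i j m => eq_neg_negShift_comm.1
    (L.skew_of_skew_coeff (fun h k n => hA.skew_coeff i j h k m n) ha)) hb

theorem integralMap_hamField_hamDer {ι : Type*} (p q r : ι) (i j h k s t : Fin N) (m n l : ℤ) :
    integralMap (jetDer D) (MvPolynomial.X (r, 0) *
      L.hamField ((A i j).coeff m) (MvPolynomial.X (p, 0))
        (L.hamDer (jetDer D) ((A h k).coeff n) (MvPolynomial.X (q, 0)) ((A s t).coeff l))) =
      (matrixRotaBaxter (Fin N) (jetDer D)).tr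
        ((matrixRotaBaxter (Fin N) (jetDer D)).adlerVariation (matrixMap (Fin N) (jetDer_C D) A)
          (testOp (jetDer D) j i m (MvPolynomial.X (p, 0)))
          (testOp (jetDer D) k h n (MvPolynomial.X (q, 0))) *
        testOp (jetDer D) t s l (MvPolynomial.X (r, 0))) := by
  set δ := L.hamField ((A i j).coeff m) (MvPolynomial.X (p, 0))
  have hcomm : ∀ w, δ (jetDer D w) = jetDer D (δ w) := L.hamField_jetDer _ _
  have hlift : matrixDer (jetDer D) δ (matrixMap (Fin N) (jetDer_C D) A) =
      matrixDer (jetDer D) (L.hamDer (jetDer D) ((A i j).coeff m) (MvPolynomial.X (p, 0))) A := by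
    ext1 i j
    ext1
    funext n
    exact L.hamField_C _ _ _
  have hself (M) : matrixMap (Fin N) (E := jetDer (ι := ι) D) (fun _ => rfl) M = M := by
    ext1 i j
    rfl
  rw [← coeff_matrixDer, ← coeff_matrixDer, ← tr_mul_testOp, hA.matrixDer_hamDer (jetDer_C D),
    matrixDer_adler (fun _ => rfl) δ hcomm _ _ _
      (matrixDer_testOp (fun _ => rfl) δ hcomm _ _ _ (L.hamField_X _ _ _)),
    hlift, hA.matrixDer_hamDer (jetDer_C D), hself, hself]
  rfl

theorem jacobiCycle_coeff {ι : Type*} (p q r : ι) (i j h k s t : Fin N) (m n l : ℤ) :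
    L.jacobiCycle p q r ((A i j).coeff m) ((A h k).coeff n) ((A s t).coeff l) = 0 := by
  simp only [jacobiCycle, hA.integralMap_hamField_hamDer]
  exact TracedRotaBaxter.tr_adlerVariation_cyclic _ _ _ _ _

theorem jacobiator_eq_zero_iff {a b c : V} (ha : a ∈ coeffSubalgebra A)
    (hb : b ∈ coeffSubalgebra A) (hc : c ∈ coeffSubalgebra A) :
    L.jacobiator a b c = 0 ↔ ∀ p q r : Fin 3, L.jacobiCycle p q r a b c = 0 := by
  have hcycle (p q r : Fin 3) := integralMap_X_mul_jetApply₂_jacobiator p q r (hA.skew ha hc)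
    (fun n => hA.skew (hA.br_mem_coeffsIn ha hb n) hc)
  constructor
  · intro h p q r
    rw [← hcycle, h, map_zero, mul_zero, map_zero]
  · intro h
    refine jetApply₂_injective (F := F) (D := D) (i := (0 : Fin 3)) (j := 1) (by decide) ?_
    rw [map_zero]
    exact eq_zero_of_integralMap_X_mul 2
      (pderiv_jetApply₂_of_ne (by decide) (by decide) · _) (by rw [hcycle, h])

theorem jacobiator_rotate {a b c : V} (ha : a ∈ coeffSubalgebra A)
    (hb : b ∈ coeffSubalgebra A) (hc : c ∈ coeffSubalgebra A) (h : L.jacobiator a b c = 0) :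
    L.jacobiator b c a = 0 := by
  rw [hA.jacobiator_eq_zero_iff hb hc ha]
  intro p q r
  rw [← jacobiCycle_rotate]
  exact (hA.jacobiator_eq_zero_iff ha hb hc).1 h _ _ _

end IsAdlerType

namespace LambdaBracket

variable {F : Type*} [Field F] {V : Type*} [CommRing V] [Algebra F V] {D : Derivation F V V}
  (L : LambdaBracket D)

/-- The derivation `c ↦ {a_λ {b_μ c}} - {b_μ {a_λ c}} - {{a_λ b}_{λ+μ} c}`, tested on the `i`-th
and `j`-th indeterminates. -/
noncomputable def jacobiatorDer {ι : Type*} (i j : ι) (a b : V) :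
    Derivation F V (MvPolynomial (ι × ℕ) V) :=
  ⁅L.hamField a (MvPolynomial.X (i, 0)), L.hamField b (MvPolynomial.X (j, 0))⁆.compAlgebraMap V -
    L.nestedDer i j (L.br a b)

theorem jacobiatorDer_apply {ι : Type*} (i j : ι) (a b c : V) :
    L.jacobiatorDer i j a b c = jetApply₂ D i j (L.jacobiator a b c) := by
  rw [jetApply₂_jacobiator, ← hamField_C, ← hamField_C, ← Derivation.commutator_apply]
  rfl

theorem jacobiatorDer_comm {ι : Type*} (i j : ι) (a b c : V) :
    L.jacobiatorDer i j a b (D c) = jetDer D (L.jacobiatorDer i j a b c) := by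
  simp only [jacobiatorDer_apply, jetApply₂_jacobiator, nestedDer_apply, Polynomial.sum, map_sub,
    map_sum, L.hamDer_comm (jetDer_C D), hamField_jetDer]

theorem jacobiator_eq_zero_of_coeff {N : ℕ} {A : Matrix (Fin N) (Fin N) (PseudoDiffOp D)} {a b : V}
    (h : ∀ i j m, L.jacobiator a b ((A i j).coeff m) = 0) {c : V} (hc : c ∈ coeffSubalgebra A) :
    L.jacobiator a b c = 0 := by
  refine jetApply₂_injective (F := F) (D := D) (i := (0 : Fin 2)) (j := 1) (by decide) ?_
  rw [← jacobiatorDer_apply, map_zero]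
  refine derivation_eqOn_coeffSubalgebra (δ' := 0) (L.jacobiatorDer_comm 0 1 a b)
    (fun _ => (map_zero _).symm) (fun i j m => ?_) hc
  rw [jacobiatorDer_apply, h, map_zero, Derivation.zero_apply]

end LambdaBracket

theorem IsAdlerType.jacobiator_eq_zero {F : Type*} [Field F] {V : Type*} [CommRing V]
    [Algebra F V] {D : Derivation F V V} {N : ℕ} {L : LambdaBracket D}
    {A : Matrix (Fin N) (Fin N) (PseudoDiffOp D)} (hA : IsAdlerType L A) {a b c : V}
    (ha : a ∈ coeffSubalgebra A) (hb : b ∈ coeffSubalgebra A) (hc : c ∈ coeffSubalgebra A) :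
    L.jacobiator a b c = 0 := by
  have hmem := coeff_mem_coeffSubalgebra A
  refine L.jacobiator_eq_zero_of_coeff (fun s t l => ?_) hc
  refine hA.jacobiator_rotate (hmem _ _ _) ha hb
    (L.jacobiator_eq_zero_of_coeff (fun h k n => ?_) hb)
  refine hA.jacobiator_rotate (hmem _ _ _) (hmem _ _ _) ha
    (L.jacobiator_eq_zero_of_coeff (fun i j m => ?_) ha)
  exact (hA.jacobiator_eq_zero_iff (hmem _ _ _) (hmem _ _ _) (hmem _ _ _)).2
    fun _ _ _ => hA.jacobiCycle_coeff _ _ _ _ _ _ _ _ _ _ _ _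

theorem IsAdlerType.isPVAOn {F : Type*} [Field F] {V : Type*} [CommRing V] [Algebra F V]
    {D : Derivation F V V} {N : ℕ} {L : LambdaBracket D}
    {A : Matrix (Fin N) (Fin N) (PseudoDiffOp D)} (hA : IsAdlerType L A) :
    L.IsPVAOn (coeffSubalgebra A) where
  closed _ ha _ hb := hA.br_mem_coeffsIn ha hb
  skew _ ha _ hb := hA.skew ha hb
  jacobi _ ha _ hb _ hc := sub_eq_zero.1 (hA.jacobiator_eq_zero ha hb hc)

theorem IsBiAdlerType.isBiPVAOn {F : Type*} [Field F] {V : Type*} [CommRing V] [Algebra F V]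
    {D : Derivation F V V} {N : ℕ} {L₀ L₁ : LambdaBracket D}
    {A : Matrix (Fin N) (Fin N) (PseudoDiffOp D)} (hA : IsBiAdlerType L₀ L₁ A) :
    IsBiPVAOn L₀ L₁ (coeffSubalgebra A) := fun ε => by
  rw [← coeffSubalgebra_add_const A ε]
  exact (hA ε).isPVAOn

/-! ### The Lenard–Magri recurrence -/

section Pencil

variable {F : Type*} [Field F] {V : Type*} [CommRing V] [Algebra F V] {D : Derivation F V V}

namespace LambdaBracket

variable (L₀ L₁ : LambdaBracket D)

theorem pencil_zero : L₀.pencil L₁ 0 = L₀ := by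
  cases L₀
  simp [pencil]

theorem pencil_one_br (a b : V) : (L₀.pencil L₁ 1).br a b = L₀.br a b + L₁.br a b := by
  simp [pencil]

theorem br_add_algebraMap (L : LambdaBracket D) (a b : V) (r s : F) :
    L.br (a + algebraMap F V r) (b + algebraMap F V s) = L.br a b := by
  rw [map_add, br_algebraMap_right, add_zero, map_add, LinearMap.add_apply, br_algebraMap_left,
    add_zero]

end LambdaBracket

variable {N : ℕ}

theorem exists_coeff_add_one_apply (A : Matrix (Fin N) (Fin N) (PseudoDiffOp D)) (i j : Fin N)
    (m : ℤ) : ∃ r : F, ((A + 1) i j).coeff m = (A i j).coeff m + algebraMap F V r := by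
  refine ⟨if i = j ∧ m = 0 then 1 else 0, congrArg ((A i j).coeff m + ·) ?_⟩
  rw [Matrix.one_apply]
  by_cases hij : i = j <;> by_cases hm : m = 0 <;> simp [hij, hm, PseudoDiffOp.coeff_one]

variable {A : Matrix (Fin N) (Fin N) (PseudoDiffOp D)} {W : Type*} [CommRing W] [Algebra F W]
  [Algebra V W] [IsScalarTower F V W] {E : Derivation F W W}
  (hE : ∀ v, E (algebraMap V W v) = algebraMap V W (D v))

theorem IsAdlerType.matrixDer_cohamDer {L : LambdaBracket D} (hA : IsAdlerType L A) (h k : Fin N)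
    (m : ℤ) (f : W) :
    matrixDer E (L.cohamDer hE ((A h k).coeff m) f) A =
      -(matrixRotaBaxter (Fin N) E).adler (matrixMap (Fin N) hE A) (matrixMap (Fin N) hE A)
        (testOp E k h m f) := by
  rw [← hA.matrixDer_hamDer hE]
  ext i j n
  change symbolCoapply E f (L.br _ _) = -symbolApply E f _
  rw [hA.skew_coeff i j, map_neg, symbolApply_negShift hE, neg_neg]

namespace IsBiAdlerType

variable {L₀ L₁ : LambdaBracket D} (hA : IsBiAdlerType L₀ L₁ A)

include hA

theorem isAdlerType : IsAdlerType L₀ A := by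
  have h := hA 0
  rwa [pencil_zero, map_zero, const_zero, Matrix.diagonal_zero, add_zero] at h

theorem isAdlerType_add_one : IsAdlerType (L₀.pencil L₁ 1) (A + 1) := by
  have h := hA 1
  rw [map_one] at h
  exact h

theorem matrixDer_cohamDer (h k : Fin N) (m : ℤ) (f : W) :
    matrixDer E (L₁.cohamDer hE ((A h k).coeff m) f) A =
      -((matrixRotaBaxter (Fin N) E).adler (matrixMap (Fin N) hE A) 1 (testOp E k h m f) +
        (matrixRotaBaxter (Fin N) E).adler 1 (matrixMap (Fin N) hE A) (testOp E k h m f)) := by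
  have hpencil : matrixDer E ((L₀.pencil L₁ 1).cohamDer hE (((A + 1) h k).coeff m) f) (A + 1) =
      matrixDer E (L₀.cohamDer hE ((A h k).coeff m) f) A +
        matrixDer E (L₁.cohamDer hE ((A h k).coeff m) f) A := by
    ext i j n
    obtain ⟨r, hr⟩ := exists_coeff_add_one_apply A i j n
    obtain ⟨s, hs⟩ := exists_coeff_add_one_apply A h k m
    rw [coeff_matrixDer, hr, hs, cohamDer_apply, br_add_algebraMap, pencil_one_br, map_add]
    rfl
  rw [hA.isAdlerType_add_one.matrixDer_cohamDer hE, hA.isAdlerType.matrixDer_cohamDer hE,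
    map_add, map_one, eq_neg_add_iff_add_eq] at hpencil
  rw [← hpencil]
  simp only [TracedRotaBaxter.adler, mul_add, add_mul, map_add, mul_one, one_mul]
  abel

end IsBiAdlerType

end Pencil

section Recurrence

variable {F : Type*} [Field F] {V : Type*} [CommRing V] [Algebra F V] {D : Derivation F V V}
  {N : ℕ} {A B : (Matrix (Fin N) (Fin N) (PseudoDiffOp D))ˣ} {K : ℤ}

theorem hDensity_zero (K : ℤ) (B : (Matrix (Fin N) (Fin N) (PseudoDiffOp D))ˣ) :
    hDensity K B 0 = 0 := if_pos rfl

theorem laxCommutator_zero (A B : (Matrix (Fin N) (Fin N) (PseudoDiffOp D))ˣ) :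
    laxCommutator A B 0 = 0 := by
  have hpos : (1 : Matrix (Fin N) (Fin N) (PseudoDiffOp D)).map PseudoDiffOp.pos = 1 := by
    ext i j p
    rw [Matrix.map_apply, coeff_pos, Matrix.one_apply]
    split_ifs with hp hij <;> simp [PseudoDiffOp.coeff_one]
    omega
  rw [laxCommutator, zpow_zero, Units.val_one, hpos, Ring.lie_def, one_mul, mul_one, sub_self]

theorem tr_laxCommutator {W : Type*} [CommRing W] [Algebra F W] [Algebra V W]
    [IsScalarTower F V W] {E : Derivation F W W}
    (hE : ∀ v, E (algebraMap V W v) = algebraMap V W (D v))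
    (A B : (Matrix (Fin N) (Fin N) (PseudoDiffOp D))ˣ) (n : ℤ) (h k : Fin N) (m : ℤ) (f : W) :
    (matrixRotaBaxter (Fin N) E).tr
      (⁅(matrixRotaBaxter (Fin N) E).pos (matrixMap (Fin N) hE ↑(B ^ n)),
        matrixMap (Fin N) hE A.val⁆ * testOp E k h m f) =
      integralMap E (f * algebraMap V W ((laxCommutator A B n h k).coeff m)) := by
  rw [Ring.lie_def, ← matrixMap_pos, ← map_mul, ← map_mul, ← map_sub, tr_mul_testOp,
    coeff_matrixMap]
  rfl

namespace IsOperatorRoot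

variable (hB : IsOperatorRoot A B K)

include hB

theorem commute_zpow (n : ℤ) : Commute (↑(B ^ n) : Matrix (Fin N) (Fin N) (PseudoDiffOp D)) A := by
  rw [← hB.2]
  exact ((Commute.refl B).zpow_zpow n K).units_val

section Test

variable [CharZero F] {W : Type*} [CommRing W] [Algebra F W] [Algebra V W] [IsScalarTower F V W]
  {E : Derivation F W W} (hE : ∀ v, E (algebraMap V W v) = algebraMap V W (D v))

theorem integralMap_derivation_hDensity {n : ℤ} (hn : n ≠ 0) (δ : Derivation F V W)
    (hδ : ∀ v, δ (D v) = E (δ v)) :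
    integralMap E (δ (hDensity K B n)) = -(matrixRotaBaxter (Fin N) E).tr
      (matrixMap (Fin N) hE ↑(B ^ (n - K)) * matrixDer E δ A.val) := by
  have hroot := zsmul_trace_derivation_zpow (matrixRotaBaxter (Fin N) E).tr
    (matrixRotaBaxter (Fin N) E).tr_mul_comm (matrixMap (Fin N) hE) (matrixDer E δ)
    (matrixDer_mul hE δ hδ) B n K
  rw [hB.2, ← Int.cast_smul_eq_zsmul F, ← Int.cast_smul_eq_zsmul F] at hroot
  rw [hDensity, if_neg hn, δ.map_smul, map_smul, integralMap_derivation_trace, neg_div, neg_smul,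
    div_eq_inv_mul, mul_smul, hroot, inv_smul_smul₀ (Int.cast_ne_zero.2 hn)]

include hE

theorem integralMap_mul_action {n : ℤ} (hn : n ≠ 0) (L : LambdaBracket D) (u : V) (f : W) :
    integralMap E (f * algebraMap V W (L.action (integralMap D (hDensity K B n)) u)) =
      -(matrixRotaBaxter (Fin N) E).tr
        (matrixMap (Fin N) hE ↑(B ^ (n - K)) * matrixDer E (L.cohamDer hE u f) A.val) := by
  rw [← hB.integralMap_derivation_hDensity hE hn _ (L.cohamDer_comm hE u f), cohamDer_apply,
    integralMap_symbolCoapply, action_integral, Algebra.smul_def, mul_comm]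

theorem integralMap_mul_action_zero {L : LambdaBracket D} (hA : IsAdlerType L A.val) {n : ℤ}
    (hn : n ≠ 0) (h k : Fin N) (m : ℤ) (f : W) :
    integralMap E (f * algebraMap V W
        (L.action (integralMap D (hDensity K B n)) ((A.val h k).coeff m))) =
      integralMap E (f * algebraMap V W ((laxCommutator A B n h k).coeff m)) := by
  have hpow : (↑(B ^ (n - K)) : Matrix (Fin N) (Fin N) (PseudoDiffOp D)) * A = ↑(B ^ n) := by
    rw [← hB.2, ← Units.val_mul, ← zpow_add, sub_add_cancel]
  have hcomm := (hB.commute_zpow (n - K)).map (matrixMap (Fin N) hE)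
  rw [hB.integralMap_mul_action hE hn, hA.matrixDer_cohamDer, mul_neg, map_neg, neg_neg,
    (matrixRotaBaxter (Fin N) E).tr_mul_comm, TracedRotaBaxter.tr_adler_mul_of_commute _ hcomm,
    ← map_mul, hpow, tr_laxCommutator]

theorem integralMap_mul_action_one {L₀ L₁ : LambdaBracket D} (hA : IsBiAdlerType L₀ L₁ A.val)
    {n : ℤ} (hn : n ≠ -K) (h k : Fin N) (m : ℤ) (f : W) :
    integralMap E (f * algebraMap V W
        (L₁.action (integralMap D (hDensity K B (n + K))) ((A.val h k).coeff m))) =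
      integralMap E (f * algebraMap V W ((laxCommutator A B n h k).coeff m)) := by
  have hcomm := (hB.commute_zpow n).map (matrixMap (Fin N) hE)
  rw [hB.integralMap_mul_action hE (by omega), hA.matrixDer_cohamDer, mul_neg, map_neg, neg_neg,
    add_sub_cancel_right, (matrixRotaBaxter (Fin N) E).tr_mul_comm,
    TracedRotaBaxter.tr_adler_one_mul_of_commute _ hcomm, tr_laxCommutator]

end Test

theorem action_hDensity_zero [CharZero F] {L : LambdaBracket D} (hA : IsAdlerType L A.val) (n : ℤ)
    (h k : Fin N) (m : ℤ) :
    L.action (integralMap D (hDensity K B n)) ((A.val h k).coeff m) =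
      (laxCommutator A B n h k).coeff m := by
  obtain rfl | hn := eq_or_ne n 0
  · rw [hDensity_zero, laxCommutator_zero, map_zero, map_zero]
    rfl
  exact eq_of_integralMap_X_mul_C () (hB.integralMap_mul_action_zero (jetDer_C D) hA hn h k m _)

theorem action_hDensity_one [CharZero F] {L₀ L₁ : LambdaBracket D}
    (hA : IsBiAdlerType L₀ L₁ A.val) {n : ℤ} (hn : n ≠ -K) (h k : Fin N) (m : ℤ) :
    L₁.action (integralMap D (hDensity K B (n + K))) ((A.val h k).coeff m) =
      (laxCommutator A B n h k).coeff m :=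
  eq_of_integralMap_X_mul_C () (hB.integralMap_mul_action_one (jetDer_C D) hA hn h k m _)

end IsOperatorRoot

end Recurrence

/-! ### Commuting Hamiltonian flows -/

section HamiltonianFlows

variable {F : Type*} [Field F] {V : Type*} [CommRing V] [Algebra F V] {D : Derivation F V V}

namespace LambdaBracket

theorem action_mul (L : LambdaBracket D) (f : LocalFunctional D) (a b : V) :
    L.action f (a * b) = a * L.action f b + b * L.action f a := by
  obtain ⟨f, rfl⟩ := Submodule.mkQ_surjective _ f
  change (L.br f (a * b)).coeff 0 = a * (L.br f b).coeff 0 + b * (L.br f a).coeff 0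
  rw [L.leibniz_right, Polynomial.coeff_add, coeff_C_mul, coeff_C_mul, add_comm]

theorem action_derivation (L : LambdaBracket D) (f : LocalFunctional D) (a : V) :
    L.action f (D a) = D (L.action f a) := by
  obtain ⟨f, rfl⟩ := Submodule.mkQ_surjective _ f
  change (L.br f (D a)).coeff 0 = D ((L.br f a).coeff 0)
  rw [L.sesq_right, coeff_lambdaAdd, coeff_X_mul_zero, zero_add]

/-- The evolutionary derivation `{∫f, ·}` of the Hamiltonian functional `∫f`. -/
noncomputable def actionDer (L : LambdaBracket D) (f : LocalFunctional D) : Derivation F V V :=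
  Derivation.mk' (L.action f) (L.action_mul f)

theorem functionalBracket_integral_right (L : LambdaBracket D) (f : LocalFunctional D) (g : V) :
    L.functionalBracket f (integralMap D g) = integralMap D (L.action f g) := rfl

variable {L₀ L₁ : LambdaBracket D} {N : ℕ}

theorem action_eqOn_coeffSubalgebra {A : Matrix (Fin N) (Fin N) (PseudoDiffOp D)}
    {f g : LocalFunctional D}
    (h : ∀ i j m, L₀.action f ((A i j).coeff m) = L₁.action g ((A i j).coeff m)) :
    Set.EqOn (L₀.action f) (L₁.action g) (coeffSubalgebra A) :=
  derivation_eqOn_coeffSubalgebra (δ := L₀.actionDer f) (δ' := L₁.actionDer g)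
    (L₀.action_derivation f) (L₁.action_derivation g) h

end LambdaBracket

namespace IsOperatorRoot

variable [CharZero F] {N : ℕ} {A B C : (Matrix (Fin N) (Fin N) (PseudoDiffOp D))ˣ} {K K₁ K₂ : ℤ}

theorem functionalBracket_eq_zero_of_lax (hC : IsOperatorRoot A C K) (L : LambdaBracket D)
    (f : LocalFunctional D) (P : Matrix (Fin N) (Fin N) (PseudoDiffOp D))
    (hP : ∀ h k m, L.action f ((A.val h k).coeff m) = (⁅P, A.val⁆ h k).coeff m) (n : ℤ) :
    L.functionalBracket f (integralMap D (hDensity K C n)) = 0 := by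
  obtain rfl | hn := eq_or_ne n 0
  · rw [hDensity_zero, map_zero, map_zero]
  have hid (M : Matrix (Fin N) (Fin N) (PseudoDiffOp D)) :
      matrixMap (E := D) (Fin N) (fun _ => rfl) M = M := rfl
  have hlax : matrixDer D (L.actionDer f) A.val = ⁅P, A.val⁆ := by
    ext h k m
    exact hP h k m
  have hconserved := hC.integralMap_derivation_hDensity (E := D) (fun _ => rfl) hn (L.actionDer f)
    (L.action_derivation f)
  rwa [hid, hlax, TracedRotaBaxter.tr_mul_lie_of_commute _ (hC.commute_zpow _) P, neg_zero]
    at hconserved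

theorem functionalBracket_hDensity_zero {L : LambdaBracket D} (hA : IsAdlerType L A.val)
    (hB : IsOperatorRoot A B K₁) (hC : IsOperatorRoot A C K₂) (m n : ℤ) :
    L.functionalBracket (integralMap D (hDensity K₁ B m)) (integralMap D (hDensity K₂ C n)) = 0 :=
  hC.functionalBracket_eq_zero_of_lax L _ _ (hB.action_hDensity_zero hA m) n

theorem functionalBracket_hDensity_one {L₀ L₁ : LambdaBracket D} (hA : IsBiAdlerType L₀ L₁ A.val)
    (hB : IsOperatorRoot A B K₁) (hC : IsOperatorRoot A C K₂) (m n : ℤ) :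
    L₁.functionalBracket (integralMap D (hDensity K₁ B m)) (integralMap D (hDensity K₂ C n)) =
      0 := by
  obtain rfl | hm := eq_or_ne m 0
  · rw [hDensity_zero, functionalBracket_integral_right, map_zero, map_zero, LinearMap.zero_apply,
      map_zero]
  have hlax := hB.action_hDensity_one hA (n := m - K₁) (by omega)
  rw [sub_add_cancel] at hlax
  exact hC.functionalBracket_eq_zero_of_lax L₁ _ _ hlax n

end IsOperatorRoot

theorem map_sum_of_map_eq_zero {R M M' G : Type*} [Semiring R] [AddCommMonoid M]
    [AddCommMonoid M'] [FunLike G M M'] [AddMonoidHomClass G M M'] (e : G) (p : R[X])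
    (f : ℕ → R → M) (hf : f 0 0 = 0) (h : ∀ n r, n ≠ 0 → e (f n r) = 0) :
    e (p.sum f) = e (f 0 (p.coeff 0)) := by
  rw [Polynomial.sum, map_sum]
  refine Finset.sum_eq_single 0 (fun n _ hn => h n _ hn) fun h0 => ?_
  rw [notMem_support_iff.1 h0, hf, map_zero]

namespace LambdaBracket

theorem constantCoeff_jacobiator (L : LambdaBracket D) (a b c : V) :
    constantCoeff (constantCoeff (L.jacobiator a b c)) =
      L.action (integralMap D a) (L.action (integralMap D b) c) -
        L.action (integralMap D b) (L.action (integralMap D a) c) -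
      L.action (L.functionalBracket (integralMap D a) (integralMap D b)) c := by
  let e : V[X][X] →+* V := constantCoeff.comp constantCoeff
  have hX : e X = 0 := by simp [e]
  have hCX : e (C X) = 0 := by simp [e]
  have heval (p : V[X]) : e (p.eval₂ (C.comp C) (C X + X)) = p.coeff 0 := by
    have hconst : e.comp (C.comp C) = RingHom.id V := by ext v; simp [e]
    rw [hom_eval₂, hconst, map_add, hCX, hX, add_zero, eval₂_at_zero, RingHom.id_apply]
  change e (_ - _ - _) = _
  rw [map_sub, map_sub]
  refine congrArg₂ (· - ·) (congrArg₂ (· - ·) ?_ ?_) ?_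
  · refine (map_sum_of_map_eq_zero e (L.br b c) (fun n r => C (L.br a r) * X ^ n) (by simp)
      fun n r hn => ?_).trans ?_
    · rw [map_mul, map_pow, hX, zero_pow hn, mul_zero]
    · simp [e]
  · refine (map_sum_of_map_eq_zero e (L.br a c) (fun n r => (L.br b r).map C * C (X ^ n))
      (by simp) fun n r hn => ?_).trans ?_
    · rw [map_mul, map_pow C, map_pow, hCX, zero_pow hn, mul_zero]
    · simp [e]
  · refine (map_sum_of_map_eq_zero e (L.br a b)
      (fun n r => C (X ^ n) * (L.br r c).eval₂ (C.comp C) (C X + X)) (by simp)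
      fun n r hn => ?_).trans ?_
    · rw [map_mul, map_pow C, map_pow, hCX, zero_pow hn, zero_mul]
    · rw [pow_zero, map_one, one_mul, heval]
      simp

theorem IsPVAOn.actions_commute {L : LambdaBracket D} {S : Subalgebra F V} (hL : L.IsPVAOn S)
    {a b c : V} (ha : a ∈ S) (hb : b ∈ S) (hc : c ∈ S)
    (h0 : L.functionalBracket (integralMap D a) (integralMap D b) = 0) :
    L.action (integralMap D a) (L.action (integralMap D b) c) =
      L.action (integralMap D b) (L.action (integralMap D a) c) := by
  have hjacobi : L.jacobiator a b c = 0 := sub_eq_zero.2 (hL.jacobi a ha b hb c hc)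
  have hconst := L.constantCoeff_jacobiator a b c
  rw [hjacobi, map_zero, map_zero, h0, map_zero, LinearMap.zero_apply, sub_zero] at hconst
  exact sub_eq_zero.1 hconst.symm

theorem pencil_action_integral (L₀ L₁ : LambdaBracket D) (ε : F) (a b : V) :
    (pencil L₀ L₁ ε).action (integralMap D a) b =
      L₀.action (integralMap D a) b + ε • L₁.action (integralMap D a) b := by
  simp [pencil]

namespace IsBiPVAOn

variable {L₀ L₁ : LambdaBracket D} {S : Subalgebra F V} (h : IsBiPVAOn L₀ L₁ S) {a b c : V}

include h

theorem action_mem (ha : a ∈ S) (hb : b ∈ S) :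
    L₀.action (integralMap D a) b ∈ S ∧ L₁.action (integralMap D a) b ∈ S := by
  have hzero := (h 0).closed a ha b hb 0
  have hone := (h 1).closed a ha b hb 0
  rw [← action_integral, pencil_action_integral] at hzero hone
  rw [zero_smul, add_zero] at hzero
  rw [one_smul] at hone
  exact ⟨hzero, by simpa only [add_sub_cancel_left] using S.sub_mem hone hzero⟩

theorem actions_commute [CharZero F] (ha : a ∈ S) (hb : b ∈ S) (hc : c ∈ S)
    (h₀ : L₀.functionalBracket (integralMap D a) (integralMap D b) = 0)
    (h₁ : L₁.functionalBracket (integralMap D a) (integralMap D b) = 0) :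
    L₀.action (integralMap D a) (L₀.action (integralMap D b) c) =
        L₀.action (integralMap D b) (L₀.action (integralMap D a) c) ∧
      L₁.action (integralMap D a) (L₁.action (integralMap D b) c) =
        L₁.action (integralMap D b) (L₁.action (integralMap D a) c) := by
  have hpencil (ε : F) := (h ε).actions_commute ha hb hc (by
    rw [functionalBracket_integral_right] at h₀ h₁ ⊢
    rw [pencil_action_integral, map_add, map_smul, h₀, h₁, smul_zero, add_zero])
  simp only [pencil_action_integral, map_add, map_smul, smul_add] at hpencil
  -- The commutator is a quadratic polynomial in `ε`; its second difference isolates `L₁`.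
  have hzero := hpencil 0
  have hone := hpencil 1
  have hneg := hpencil (-1)
  simp only [zero_smul, add_zero] at hzero
  simp only [one_smul, neg_smul, smul_neg, neg_neg] at hone hneg
  refine ⟨hzero, smul_right_injective V (two_ne_zero (α := F)) ?_⟩
  simp only [two_smul]
  linear_combination hone + hneg - 2 * hzero

end IsBiPVAOn

end LambdaBracket

end HamiltonianFlows

open LambdaBracket in
theorem theorem5p2 {F : Type*} [Field F] [CharZero F] {V : Type*} [CommRing V] [Algebra F V]
    (D : Derivation F V V) (L₀ L₁ : LambdaBracket D) {N : ℕ}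
    (A : (Matrix (Fin N) (Fin N) (PseudoDiffOp D))ˣ)
    (hA : IsBiAdlerType L₀ L₁ (A : Matrix (Fin N) (Fin N) (PseudoDiffOp D))) :
    -- the generalized Lenard-Magri recurrence, for every root of `A`
    (∀ (K : ℤ) (B : (Matrix (Fin N) (Fin N) (PseudoDiffOp D))ˣ), IsOperatorRoot A B K →
      ∀ (n : ℤ) (h k : Fin N) (m : ℤ),
        L₀.action (integralMap D (hDensity K B n)) ((A.val h k).coeff m) =
            (laxCommutator A B n h k).coeff m ∧
          (n ≠ -K → L₁.action (integralMap D (hDensity K B (n + K))) ((A.val h k).coeff m) =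
            (laxCommutator A B n h k).coeff m)) ∧
    -- the coefficients of `A` generate a bi-PVA
    LambdaBracket.IsBiPVAOn L₀ L₁ (coeffSubalgebra A.val) ∧
    -- on which the equations of the hierarchy are bi-Hamiltonian
    (∀ (K : ℤ) (B : (Matrix (Fin N) (Fin N) (PseudoDiffOp D))ˣ), IsOperatorRoot A B K →
      ∀ n : ℤ, n ≠ -K → ∀ u ∈ coeffSubalgebra A.val,
        L₀.action (integralMap D (hDensity K B n)) u =
          L₁.action (integralMap D (hDensity K B (n + K))) u) ∧
    -- the Hamiltonian functionals of all roots are in involution for both brackets, hence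
    -- integrals of motion of all the equations
    (∀ (K₁ K₂ : ℤ) (B C : (Matrix (Fin N) (Fin N) (PseudoDiffOp D))ˣ),
      IsOperatorRoot A B K₁ → IsOperatorRoot A C K₂ → ∀ m n : ℤ,
        L₀.functionalBracket (integralMap D (hDensity K₁ B m)) (integralMap D (hDensity K₂ C n)) = 0 ∧
        L₁.functionalBracket (integralMap D (hDensity K₁ B m)) (integralMap D (hDensity K₂ C n)) = 0) ∧
    -- the equations with Hamiltonian functionals of the bi-PVA are flows on it, and they commute
    (∀ (K₁ K₂ : ℤ) (B C : (Matrix (Fin N) (Fin N) (PseudoDiffOp D))ˣ),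
      IsOperatorRoot A B K₁ → IsOperatorRoot A C K₂ → ∀ m n : ℤ,
        (∃ f ∈ coeffSubalgebra A.val, integralMap D f = integralMap D (hDensity K₁ B m)) →
        (∃ g ∈ coeffSubalgebra A.val, integralMap D g = integralMap D (hDensity K₂ C n)) →
        ∀ L : LambdaBracket D, L = L₀ ∨ L = L₁ → ∀ u ∈ coeffSubalgebra A.val,
          L.action (integralMap D (hDensity K₁ B m)) u ∈ coeffSubalgebra A.val ∧
          L.action (integralMap D (hDensity K₁ B m))
              (L.action (integralMap D (hDensity K₂ C n)) u) =
            L.action (integralMap D (hDensity K₂ C n))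
              (L.action (integralMap D (hDensity K₁ B m)) u)) := by
  have hA₀ := hA.isAdlerType
  have hPVA := hA.isBiPVAOn
  refine ⟨fun K B hB n h k m =>
      ⟨hB.action_hDensity_zero hA₀ n h k m, fun hn => hB.action_hDensity_one hA hn h k m⟩,
    hPVA,
    fun K B hB n hn => action_eqOn_coeffSubalgebra fun h k m =>
      (hB.action_hDensity_zero hA₀ n h k m).trans (hB.action_hDensity_one hA hn h k m).symm,
    fun K₁ K₂ B C hB hC m n =>
      ⟨hB.functionalBracket_hDensity_zero hA₀ hC m n, hB.functionalBracket_hDensity_one hA hC m n⟩,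
    ?_⟩
  rintro K₁ K₂ B C hB hC m n ⟨f, hf, hfB⟩ ⟨g, hg, hgC⟩ L hL u hu
  have hzero := hB.functionalBracket_hDensity_zero hA₀ hC m n
  have hone := hB.functionalBracket_hDensity_one hA hC m n
  rw [← hfB, ← hgC] at hzero hone ⊢
  have hmem := hPVA.action_mem hf hu
  have hcomm := hPVA.actions_commute hf hg hu hzero hone
  rcases hL with rfl | rfl
  exacts [⟨hmem.1, hcomm.1⟩, ⟨hmem.2, hcomm.2⟩]
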